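/- A *symmetric channel* is a mixture of binary symmetric channels: it is given by a probability measure $\nu$ on $[0,1/2]$, and on input $x\in\mathbb F_2$ it draws $\epsilon\sim\nu$, then $w\sim\mathrm{Ber}(\epsilon)$ given $\epsilon$, and outputs $(\epsilon,x+w)$; distinct uses of the channel are independent. Its capacity $C$ is the supremum over input distributions of the mutual information, in bits, between input and output. The Reed–Muller code $RM(m,r)\subseteq\mathbb F_2^{n}$, $n=2^m$, is the linear code of all evaluation vectors on $\mathbb F_2^m$ of polynomials over $\mathbb F_2$ in $m$ variables of degree at most $r$; its rate is $\dim RM(m,r)/n$. For a linear code of length $n$, let $X$ be a codeword (random with an arbitrary law, e.g. uniform or deterministic), sent coordinate by coordinate over the channel, with noise independent of $X$ and output $Y=(Y_1,\dots,Y_n)$. Let $\hat X_i(Y)$ be a maximum likelihood decoder of the $i$-th coordinate of the codeword based on $Y$, i.e. $\hat X_i(y)$ is a value $b\in\mathbb F_2$ that maximizes the sum of the likelihoods of $y$ over all codewords whose $i$-th coordinate is $b$, with ties broken in any way. Put $P_{\mathrm{bit}}=\max_{i\in[n]}\mathbb P(X_i\neq\hat X_i(Y))$. **Corollary.** Let $\nu$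 be a symmetric channel of capacity $C$, and let $RM(m_k,r_k)$, $k\in\mathbb N$, be Reed–Muller codes with block lengths $n_k=2^{m_k}$, $m_k\to\infty$, and rates $R_k$ such that $\limsup_{k\to\infty}R_k<C$. Then for every choice of the laws of the transmitted codewords and of the maximum likelihood bit decoders, $$P_{\mathrm{bit}}=O\!\left(2^{-\sqrt{\log_2 n_k}/\log_2\log_2 n_k}\right)\qquad(k\to\infty).$$ -/

import Mathlib

open Filter MeasureTheory

noncomputable section

/-! ### Symmetric channels

A symmetric channel is a mixture of binary symmetric channels. It is given by a probability
measure `ν` on the interval `[0, 1/2]`: on input `x` it draws `ε ~ ν`, then `w ~ Ber(ε)`, and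
outputs the pair `(ε, x + w)`. Different uses of the channel are independent. -/

/-- The values of a crossover probability. -/
abbrev Crossover : Type := Set.Icc (0 : ℝ) (1 / 2)

/-- The output alphabet of a symmetric channel. A noise variable `(ε, w)` has the same type. -/
abbrev ChannelSymbol : Type := Crossover × ZMod 2

/-- The probability that a binary symmetric channel of crossover probability `ε` outputs `u` on
input `x`. As a function of `y = (ε, u)` this is the density of the output of a symmetric channel
on input `x` with respect to the product of `ν` and the counting measure. -/
def transition (x : ZMod 2) (y : ChannelSymbol) : ℝ :=
  if y.2 = x then 1 - (y.1 : ℝ) else (y.1 : ℝ)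

/-- The law of the noise `(ε, w)`, where `ε ~ ν` and, given `ε`, `w ~ Ber(ε)`. -/
def noiseLaw (ν : Measure Crossover) : Measure ChannelSymbol :=
  (ν.prod Measure.count).withDensity (fun z => ENNReal.ofReal (transition 0 z))

/-- The channel output on input `x` under the noise `z = (ε, w)`. -/
def channelOutput (x : ZMod 2) (z : ChannelSymbol) : ChannelSymbol := (z.1, x + z.2)

/-- The joint law of the input and the output of one use of the channel, for an input
distribution `p`. -/
def inputOutputLaw (ν : Measure Crossover) (p : Measure (ZMod 2)) :
    Measure (ZMod 2 × ChannelSymbol) :=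
  (p.prod (noiseLaw ν)).map (fun q => (q.1, channelOutput q.1 q.2))

/-- The capacity in bits: the supremum over all input distributions of the mutual information of
input and output, i.e. of the relative entropy of their joint law with respect to the product of
its marginals. -/
def capacity (ν : Measure Crossover) : ℝ :=
  (⨆ p : ProbabilityMeasure (ZMod 2),
    InformationTheory.klDiv (inputOutputLaw ν p)
      ((inputOutputLaw ν p).fst.prod (inputOutputLaw ν p).snd)).toReal / Real.log 2

/-! ### Linear codes and their bit-error probability -/

section Codes

variable {ι : Type} [Fintype ι]

/-- The rate of a binary linear code with coordinates indexed by `ι`. -/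
def codeRate (C : Submodule (ZMod 2) (ι → ZMod 2)) : ℝ :=
  (Module.finrank (ZMod 2) C : ℝ) / Fintype.card ι

open scoped Classical in
/-- The likelihood of `X_i = b` given `Y = y`, for a uniformly random codeword `X`: the sum of the
likelihoods of all codewords whose coordinate `i` is `b`. (The normalization is omitted: if both
values of `b` occur, they occur in the same number of codewords.) -/
def bitLikelihood (C : Submodule (ZMod 2) (ι → ZMod 2)) (i : ι) (b : ZMod 2)
    (y : ι → ChannelSymbol) : ℝ :=
  ∑ c : ι → ZMod 2 with c ∈ C ∧ c i = b, ∏ j, transition (c j) (y j)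

/-- `dec` is a maximum likelihood decoder of the coordinate `i` of the codeword from the whole
output `y`; ties may be broken in any way. -/
def IsMLBitDecoder (C : Submodule (ZMod 2) (ι → ZMod 2)) (i : ι)
    (dec : (ι → ChannelSymbol) → ZMod 2) : Prop :=
  ∀ (y : ι → ChannelSymbol) (b : ZMod 2), bitLikelihood C i b y ≤ bitLikelihood C i (dec y) y

/-- The probability of `X_i ≠ dec(Y)`, where the codeword `X` has law `p` and is transmitted over
the memoryless channel, the noise being independent of `X`. -/
def bitErrorProbAt (ν : Measure Crossover) (C : Submodule (ZMod 2) (ι → ZMod 2)) (p : PMF C)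
    (i : ι) (dec : (ι → ChannelSymbol) → ZMod 2) : ℝ :=
  (∑' c : C, p c * Measure.pi (fun _ : ι => noiseLaw ν)
    {z | dec (fun j => channelOutput (c.1 j) (z j)) ≠ c.1 i}).toReal

/-- The bit-error probability: the maximum over the coordinates `i` of the probability that the
decoder `dec i` of the coordinate `i` errs. -/
def bitErrorProb (ν : Measure Crossover) (C : Submodule (ZMod 2) (ι → ZMod 2)) (p : PMF C)
    (dec : ι → (ι → ChannelSymbol) → ZMod 2) : ℝ :=
  ⨆ i : ι, bitErrorProbAt ν C p i (dec i)

end Codes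

/-- The Reed–Muller code `RM(m, r)`: the evaluations on the `m`-dimensional Boolean cube of the
polynomials over `𝔽₂` in `m` variables of total degree at most `r`. -/
def reedMuller (m r : ℕ) : Submodule (ZMod 2) ((Fin m → ZMod 2) → ZMod 2) :=
  (MvPolynomial.restrictTotalDegree (Fin m) (ZMod 2) r).map (MvPolynomial.evalₗ (ZMod 2) (Fin m))

/-- The block length of `RM(m, r)`. -/
def blockLength (m : ℕ) : ℕ := 2 ^ m

end

/-!
Since mutual information is at most the divergence from the product of the input law with the
output law of the uniform input, and this divergence does not depend on the input, the capacity is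
at most `1 - 𝔼 h(ε)`, with `h` the binary entropy in bits.

The output of a uniform codeword therefore has an entropy deficit of at least `C - R` bits per
coordinate. A modified logarithmic Sobolev inequality on the cube converts this deficit into the
predictability of some bit `j` from the outputs at the *other* coordinates: the expected posterior
bias is at least `log 2 * (C - R)`. Apply this to `RM(m - l, r)` with `l` of order `√m`: as
`(m choose r) * √m ≤ 2 ^ m`, its rate exceeds that of `RM(m, r)` by at most `l / √m`.

To decode bit `i` of `RM(m, r)`, restrict the codeword to affine copies of `𝔽₂^(m - l)` that send
`j` to `i`, and take a majority vote of the predictions. If the copies come from the images of one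
`(m - l)`-dimensional subspace of the field of order `2 ^ m` under multiplication by units, then
every coordinate other than `i` is used by fewer than `2 ^ (m - l)` of the `2 ^ m - 1` votes.
Hence the variance of the vote is small and, by Chebyshev's inequality, it errs with probability
`O(2 ^ (-l))`. Finally, the maximum likelihood decoder errs at most twice as often as any other.
-/

open scoped Finset

noncomputable section

/-! ### Variance of a sum of functions with scattered supports -/

section Variance

/-- Bounded measurable real functions: they are integrable for every finite measure and closed under
averaging over a coordinate of a product space. -/
def IsBddMeasurable {Ω : Type*} [MeasurableSpace Ω] (f : Ω → ℝ) : Prop :=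
  Measurable f ∧ ∃ B, ∀ z, |f z| ≤ B

namespace IsBddMeasurable

variable {Ω : Type*} [MeasurableSpace Ω] {f g : Ω → ℝ}

theorem memLp (hf : IsBddMeasurable f) (p : ENNReal) (P : Measure Ω) [IsFiniteMeasure P] :
    MemLp f p P :=
  let ⟨hm, B, hB⟩ := hf
  .of_bound hm.aestronglyMeasurable B (ae_of_all _ hB)

theorem integrable (hf : IsBddMeasurable f) (P : Measure Ω) [IsFiniteMeasure P] :
    Integrable f P :=
  memLp_one_iff_integrable.1 (hf.memLp 1 P)

theorem sub (hf : IsBddMeasurable f) (hg : IsBddMeasurable g) :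
    IsBddMeasurable fun z => f z - g z := by
  obtain ⟨hm, B, hB⟩ := hf
  obtain ⟨hm', B', hB'⟩ := hg
  exact ⟨hm.sub hm', B + B', fun z => (abs_sub _ _).trans (add_le_add (hB z) (hB' z))⟩

theorem mul (hf : IsBddMeasurable f) (hg : IsBddMeasurable g) :
    IsBddMeasurable fun z => f z * g z := by
  obtain ⟨hm, B, hB⟩ := hf
  obtain ⟨hm', B', hB'⟩ := hg
  refine ⟨hm.mul hm', B * B', fun z => ?_⟩
  rw [abs_mul]
  exact mul_le_mul (hB z) (hB' z) (abs_nonneg _) ((abs_nonneg _).trans (hB z))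

theorem const_mul (hf : IsBddMeasurable f) (r : ℝ) : IsBddMeasurable fun z => r * f z :=
  mul ⟨measurable_const, |r|, fun _ => le_rfl⟩ hf

theorem sq (hf : IsBddMeasurable f) : IsBddMeasurable fun z => f z ^ 2 := by
  simpa [pow_two] using hf.mul hf

theorem sum {A : Type*} [Fintype A] {f : A → Ω → ℝ} (hf : ∀ a, IsBddMeasurable (f a)) :
    IsBddMeasurable fun z => ∑ a, f a z := by
  choose hm B hB using hf
  exact ⟨Finset.measurable_fun_sum _ fun a _ => hm a, ∑ a, B a, fun z =>
    (Finset.abs_sum_le_sum_abs _ _).trans (Finset.sum_le_sum fun a _ => hB a z)⟩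

theorem comp {Ω' : Type*} [MeasurableSpace Ω'] {φ : Ω' → Ω} (hf : IsBddMeasurable f)
    (hφ : Measurable φ) : IsBddMeasurable fun z => f (φ z) :=
  ⟨hf.1.comp hφ, hf.2.imp fun _ hB z => hB (φ z)⟩

end IsBddMeasurable

variable {ι : Type*} [DecidableEq ι] {X : ι → Type*} [∀ i, MeasurableSpace (X i)]
  (μ : ∀ i, Measure (X i))

/-- The average of `f` over the coordinate `j`, the other coordinates being fixed. -/
def coordAvg (j : ι) (f : (∀ i, X i) → ℝ) (z : ∀ i, X i) : ℝ :=
  ∫ t, f (Function.update z j t) ∂μ j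

theorem dependsOn_coordAvg {f : (∀ i, X i) → ℝ} {s : Finset ι} (hf : DependsOn f s) (j : ι) :
    DependsOn (coordAvg μ j f) (s.erase j) := by
  intro z z' h
  refine integral_congr_ae (.of_forall fun t => hf fun i hi => ?_)
  obtain rfl | hij := eq_or_ne i j
  · simp
  · simpa [hij] using h i (by simpa [hij] using hi)

theorem coordAvg_sum {A : Type*} [Fintype A] [∀ i, IsFiniteMeasure (μ i)]
    {f : A → (∀ i, X i) → ℝ} (hf : ∀ a, IsBddMeasurable (f a)) (j : ι) (z : ∀ i, X i) :
    coordAvg μ j (fun z => ∑ a, f a z) z = ∑ a, coordAvg μ j (f a) z :=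
  integral_finsetSum _ fun a _ => ((hf a).comp (measurable_update z)).integrable (μ j)

variable [∀ i, IsProbabilityMeasure (μ i)]

theorem coordAvg_eq_self {f : (∀ i, X i) → ℝ} {s : Set ι} (hf : DependsOn f s) {j : ι}
    (hj : j ∉ s) : coordAvg μ j f = f := by
  ext z
  have (t : X j) : f (Function.update z j t) = f z :=
    hf fun i hi => Function.update_of_ne (ne_of_mem_of_not_mem hi hj) ..
  simp [coordAvg, this]

theorem IsBddMeasurable.coordAvg {f : (∀ i, X i) → ℝ} (hf : IsBddMeasurable f) (j : ι) :
    IsBddMeasurable (coordAvg μ j f) := by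
  obtain ⟨hm, B, hB⟩ := hf
  have hm_update : Measurable fun p : (∀ i, X i) × X j => f (Function.update p.1 j p.2) :=
    hm.comp measurable_update'
  refine ⟨hm_update.stronglyMeasurable.integral_prod_right'.measurable, B, fun z => ?_⟩
  simpa [_root_.coordAvg] using norm_integral_le_of_norm_le_const (μ := μ j)
    (f := fun t => f (Function.update z j t)) (ae_of_all _ fun t => hB _)

variable {A : Type*} [Fintype A] {f : A → (∀ i, X i) → ℝ} {S : A → Finset ι} {Q : ℕ}

theorem sq_sum_sub_coordAvg_le (hf : ∀ a, DependsOn (f a) (S a)) (hQ : ∀ j, #{a | j ∈ S a} ≤ Q)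
    (j : ι) (z : ∀ i, X i) :
    (∑ a, (f a z - coordAvg μ j (f a) z)) ^ 2 ≤ Q * ∑ a, (f a z - coordAvg μ j (f a) z) ^ 2 := by
  have eq_zero (a : A) (ha : j ∉ S a) : f a z - coordAvg μ j (f a) z = 0 := by
    rw [coordAvg_eq_self μ (hf a) ha, sub_self]
  calc (∑ a, (f a z - coordAvg μ j (f a) z)) ^ 2
      = (∑ a with j ∈ S a, (f a z - coordAvg μ j (f a) z)) ^ 2 := by
        rw [Finset.sum_filter_of_ne fun a _ h => not_imp_comm.1 (eq_zero a) h]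
    _ ≤ #{a | j ∈ S a} * ∑ a with j ∈ S a, (f a z - coordAvg μ j (f a) z) ^ 2 :=
        sq_sum_le_card_mul_sum_sq
    _ ≤ Q * ∑ a, (f a z - coordAvg μ j (f a) z) ^ 2 := by
        gcongr
        · exact hQ j
        · exact Finset.subset_univ _

variable [Fintype ι]

theorem measurePreserving_update (j : ι) :
    MeasurePreserving (fun p : (∀ i, X i) × X j => Function.update p.1 j p.2)
      ((Measure.pi μ).prod (μ j)) (Measure.pi μ) := by
  refine ⟨measurable_update', (Measure.pi_eq fun s hs => ?_).symm⟩
  have preimage_pi : (fun p : (∀ i, X i) × X j => Function.update p.1 j p.2) ⁻¹' Set.univ.pi s =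
      Set.univ.pi (Function.update s j Set.univ) ×ˢ s j := by
    ext ⟨z, t⟩
    simp only [Set.mem_preimage, Set.mem_univ_pi, Set.mem_prod, Function.forall_update_iff z
      (fun i x => x ∈ s i), Function.forall_update_iff s (fun i u => z i ∈ u), Set.mem_univ,
      true_and]
    exact and_comm
  rw [Measure.map_apply measurable_update' (MeasurableSet.univ_pi hs), preimage_pi,
    Measure.prod_prod, Measure.pi_pi, ← Finset.prod_erase_mul _ _ (Finset.mem_univ j),
    ← Finset.prod_erase_mul _ (fun i => μ i (s i)) (Finset.mem_univ j), Function.update_self,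
    measure_univ, mul_one]
  congr 1
  refine Finset.prod_congr rfl fun i hi => ?_
  rw [Function.update_of_ne (Finset.ne_of_mem_erase hi)]

theorem integral_coordAvg {f : (∀ i, X i) → ℝ} (hf : IsBddMeasurable f) (j : ι) :
    ∫ z, coordAvg μ j f z ∂Measure.pi μ = ∫ z, f z ∂Measure.pi μ := by
  have hmp := measurePreserving_update μ j
  calc ∫ z, coordAvg μ j f z ∂Measure.pi μ
      = ∫ p, f (Function.update p.1 j p.2) ∂(Measure.pi μ).prod (μ j) :=
        (integral_prod _ ((hf.comp hmp.measurable).integrable _)).symm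
    _ = ∫ z, f z ∂Measure.pi μ := by
        rw [← integral_map hmp.measurable.aemeasurable hf.1.aestronglyMeasurable, hmp.map_eq]

theorem integral_mul_coordAvg {f : (∀ i, X i) → ℝ} (hf : IsBddMeasurable f) (j : ι) :
    ∫ z, f z * coordAvg μ j f z ∂Measure.pi μ = ∫ z, coordAvg μ j f z ^ 2 ∂Measure.pi μ := by
  rw [← integral_coordAvg μ (hf.mul (hf.coordAvg μ j)) j]
  congr 1 with z
  calc coordAvg μ j (fun z => f z * coordAvg μ j f z) z
      = ∫ t, f (Function.update z j t) * coordAvg μ j f z ∂μ j := by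
        simp only [coordAvg, Function.update_idem]
    _ = coordAvg μ j f z ^ 2 := by rw [integral_mul_const, pow_two, coordAvg]

open ProbabilityTheory

theorem variance_sub_variance_coordAvg {f : (∀ i, X i) → ℝ} (hf : IsBddMeasurable f) (j : ι) :
    Var[f; Measure.pi μ] - Var[coordAvg μ j f; Measure.pi μ] =
      ∫ z, (f z - coordAvg μ j f z) ^ 2 ∂Measure.pi μ := by
  have hg := hf.coordAvg μ j
  have expand (z) : (f z - coordAvg μ j f z) ^ 2 =
      f z ^ 2 + coordAvg μ j f z ^ 2 - 2 * (f z * coordAvg μ j f z) := by ring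
  simp only [expand, variance_eq_sub (hf.memLp 2 _), variance_eq_sub (hg.memLp 2 _), Pi.pow_apply]
  rw [integral_sub (f := fun z => f z ^ 2 + coordAvg μ j f z ^ 2)
      ((hf.sq.integrable _).add (hg.sq.integrable _))
      (((hf.mul hg).integrable _).const_mul 2), integral_add (hf.sq.integrable _)
      (hg.sq.integrable _), integral_const_mul, integral_mul_coordAvg μ hf,
    integral_coordAvg μ hf]
  ring

theorem variance_sum_sub_variance_sum_coordAvg_le (hb : ∀ a, IsBddMeasurable (f a))
    (hf : ∀ a, DependsOn (f a) (S a)) (hQ : ∀ j, #{a | j ∈ S a} ≤ Q) (j : ι) :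
    Var[fun z => ∑ a, f a z; Measure.pi μ] - Var[fun z => ∑ a, coordAvg μ j (f a) z; Measure.pi μ] ≤
      Q * ∑ a, (Var[f a; Measure.pi μ] - Var[coordAvg μ j (f a); Measure.pi μ]) := by
  have hsq (a : A) : IsBddMeasurable fun z => (f a z - coordAvg μ j (f a) z) ^ 2 :=
    ((hb a).sub ((hb a).coordAvg μ j)).sq
  simp only [← coordAvg_sum μ hb, variance_sub_variance_coordAvg μ (.sum hb),
    variance_sub_variance_coordAvg μ (hb _)]
  rw [← integral_finsetSum _ fun a _ => (hsq a).integrable _, ← integral_const_mul]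
  refine integral_mono (((IsBddMeasurable.sum hb).sub ((IsBddMeasurable.sum hb).coordAvg μ j)).sq
    |>.integrable _) (((IsBddMeasurable.sum hsq).integrable _).const_mul _) fun z => ?_
  simpa only [coordAvg_sum μ hb, ← Finset.sum_sub_distrib] using
    sq_sum_sub_coordAvg_le μ hf hQ j z

theorem variance_sum_le (hb : ∀ a, IsBddMeasurable (f a)) (hf : ∀ a, DependsOn (f a) (S a))
    (hQ : ∀ j, #{a | j ∈ S a} ≤ Q) :
    Var[fun z => ∑ a, f a z; Measure.pi μ] ≤ Q * ∑ a, Var[f a; Measure.pi μ] := by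
  suffices ∀ (s : Finset ι) (f : A → (∀ i, X i) → ℝ) (S : A → Finset ι), (∀ a, S a ⊆ s) →
      (∀ a, IsBddMeasurable (f a)) → (∀ a, DependsOn (f a) (S a)) → (∀ j, #{a | j ∈ S a} ≤ Q) →
      Var[fun z => ∑ a, f a z; Measure.pi μ] ≤ Q * ∑ a, Var[f a; Measure.pi μ] from
    this Finset.univ f S (fun a => Finset.subset_univ _) hb hf hQ
  intro s
  induction s using Finset.induction_on with
  | empty =>
    intro f S hS _ hf _
    obtain ⟨z₀⟩ : Nonempty (∀ i, X i) := (Measure.pi μ).nonempty_of_neZero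
    have eq_const (z) : ∑ a, f a z = ∑ a, f a z₀ :=
      Finset.sum_congr rfl fun a _ => hf a (by simp [Finset.subset_empty.1 (hS a)])
    rw [funext eq_const, ← covariance_self aemeasurable_const, covariance_const_left]
    exact mul_nonneg Q.cast_nonneg (Finset.sum_nonneg fun a _ => variance_nonneg _ _)
  | insert j s _ ih =>
    intro f S hS hb hf hQ
    have after := ih (fun a => coordAvg μ j (f a)) (fun a => (S a).erase j)
      (fun a => Finset.subset_insert_iff.1 (hS a)) (fun a => (hb a).coordAvg μ j)
      (fun a => dependsOn_coordAvg μ (hf a) j)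
      (fun i => (Finset.card_le_card <| Finset.monotone_filter_right _ fun a _ =>
        Finset.mem_of_mem_erase).trans (hQ i))
    have drop := variance_sum_sub_variance_sum_coordAvg_le μ hb hf hQ j
    rw [Finset.sum_sub_distrib, mul_sub] at drop
    linarith

theorem measureReal_sum_nonpos_le (hfm : ∀ a, Measurable (f a)) (hf1 : ∀ a z, |f a z| ≤ 1)
    (hf : ∀ a, DependsOn (f a) (S a)) (hQ : ∀ j, #{a | j ∈ S a} ≤ Q) {δ : ℝ} (hδ : 0 < δ)
    (hmean : ∀ a, δ ≤ ∫ z, f a z ∂Measure.pi μ) [Nonempty A] :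
    (Measure.pi μ).real {z | ∑ a, f a z ≤ 0} ≤ Q / (Fintype.card A * δ ^ 2) := by
  have hb (a : A) : IsBddMeasurable (f a) := ⟨hfm a, 1, hf1 a⟩
  have : (0 : ℝ) < Fintype.card A := by exact_mod_cast Fintype.card_pos
  have mean_ge : Fintype.card A * δ ≤ ∫ z, ∑ a, f a z ∂Measure.pi μ := by
    rw [integral_finsetSum _ fun a _ => (hb a).integrable _, ← nsmul_eq_mul, ← Finset.card_univ]
    exact Finset.card_nsmul_le_sum _ _ _ fun a _ => hmean a
  have variance_le : Var[fun z => ∑ a, f a z; Measure.pi μ] ≤ Q * Fintype.card A := by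
    have variance_le_one (a : A) : Var[f a; Measure.pi μ] ≤ 1 := by
      simpa using variance_le_sq_of_bounded (μ := Measure.pi μ)
        (ae_of_all _ fun z => Set.mem_Icc.2 (abs_le.1 (hf1 a z))) (hfm a).aemeasurable
    calc Var[fun z => ∑ a, f a z; Measure.pi μ] ≤ Q * ∑ a, Var[f a; Measure.pi μ] :=
          variance_sum_le μ hb hf hQ
      _ ≤ Q * ∑ _ : A, 1 := by gcongr with a; exact variance_le_one a
      _ = Q * Fintype.card A := by simp
  have subset : {z | ∑ a, f a z ≤ 0} ⊆ {z | Fintype.card A * δ ≤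
      |∑ a, f a z - ∫ z, ∑ a, f a z ∂Measure.pi μ|} := by
    intro z hz
    rw [Set.mem_ofPred_eq] at hz ⊢
    rw [le_abs]
    right
    linarith
  calc (Measure.pi μ).real {z | ∑ a, f a z ≤ 0}
      ≤ Var[fun z => ∑ a, f a z; Measure.pi μ] / (Fintype.card A * δ) ^ 2 :=
        ENNReal.toReal_le_of_le_ofReal (div_nonneg (variance_nonneg _ _) (sq_nonneg _)) <|
          (measure_mono subset).trans <|
            meas_ge_le_variance_div_sq ((IsBddMeasurable.sum hb).memLp 2 _) (by positivity)
    _ ≤ Q * Fintype.card A / (Fintype.card A * δ) ^ 2 := by gcongr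
    _ = Q / (Fintype.card A * δ ^ 2) := by field_simp

end Variance

section CompInjective

open ProbabilityTheory

variable {ι κ : Type*} [Fintype ι] [Fintype κ] {X : ι → Type*} [∀ i, MeasurableSpace (X i)]

theorem measurePreserving_pi_comp_injective (μ : ∀ i, Measure (X i))
    [∀ i, IsProbabilityMeasure (μ i)] {φ : κ → ι} (hφ : Function.Injective φ) :
    MeasurePreserving (fun (z : ∀ i, X i) k => z (φ k)) (Measure.pi μ)
      (Measure.pi fun k => μ (φ k)) := by
  have indep : iIndepFun (fun k (z : ∀ i, X i) => z (φ k)) (Measure.pi μ) :=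
    (iIndepFun_pi (X := fun _ => id) fun _ => aemeasurable_id).precomp hφ
  refine ⟨by fun_prop, ?_⟩
  rw [(iIndepFun_iff_map_fun_eq_pi_map fun k => (measurable_pi_apply _).aemeasurable).1 indep]
  congr with k : 1
  exact (measurePreserving_eval μ (φ k)).map_eq

end CompInjective

/-! ### An entropy inequality on the Boolean cube -/

section Cube

open Function (update)

theorem mul_log_add_mul_log_le {a b : ℝ} (ha : 0 ≤ a) (hb : 0 ≤ b) :
    a * Real.log a + b * Real.log b ≤
      2 * ((a + b) / 2 * Real.log ((a + b) / 2)) + (a - b) ^ 2 / (a + b) := by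
  obtain h | h := (add_nonneg ha hb).eq_or_lt
  · obtain ⟨rfl, rfl⟩ := (add_eq_zero_iff_of_nonneg ha hb).1 h.symm
    simp
  have log_le {x : ℝ} (hx : 0 ≤ x) :
      x * Real.log x ≤ x * Real.log ((a + b) / 2) + x * (x / ((a + b) / 2) - 1) := by
    obtain rfl | hx := hx.eq_or_lt
    · simp
    · rw [← sub_le_iff_le_add', ← mul_sub, ← Real.log_div hx.ne' (by positivity)]
      gcongr
      exact Real.log_le_sub_one_of_pos (by positivity)
  have remainder : a * (a / ((a + b) / 2) - 1) + b * (b / ((a + b) / 2) - 1) =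
      (a - b) ^ 2 / (a + b) := by
    field_simp
    ring
  linarith [log_le ha, log_le hb]

theorem sq_sub_div_add_subadditive {a b c d : ℝ} (ha : 0 ≤ a) (hb : 0 ≤ b) (hc : 0 ≤ c)
    (hd : 0 ≤ d) : ((a + c) - (b + d)) ^ 2 / ((a + c) + (b + d)) ≤
      (a - b) ^ 2 / (a + b) + (c - d) ^ 2 / (c + d) := by
  obtain hab | hab := (add_nonneg ha hb).eq_or_lt
  · obtain ⟨rfl, rfl⟩ := (add_eq_zero_iff_of_nonneg ha hb).1 hab.symm
    simp
  obtain hcd | hcd := (add_nonneg hc hd).eq_or_lt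
  · obtain ⟨rfl, rfl⟩ := (add_eq_zero_iff_of_nonneg hc hd).1 hcd.symm
    simp
  rw [div_add_div _ _ hab.ne' hcd.ne', div_le_div_iff₀ (by linarith) (by positivity)]
  nlinarith [sq_nonneg ((a - b) * (c + d) - (c - d) * (a + b)), mul_pos hab hcd]

variable {ι : Type*} [DecidableEq ι]

/-- The average of `f` over the two values of the coordinate `j`. -/
def cubeAvg (j : ι) (f : (ι → ZMod 2) → ℝ) (u : ι → ZMod 2) : ℝ :=
  (f (update u j 0) + f (update u j 1)) / 2

theorem dependsOn_cubeAvg {f : (ι → ZMod 2) → ℝ} {j : ι} {s : Finset ι}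
    (hf : DependsOn f (insert j s : Finset ι)) : DependsOn (cubeAvg j f) s := by
  intro u u' h
  have agree (v : ZMod 2) : f (update u j v) = f (update u' j v) := hf fun i hi => by
    obtain rfl | hij := eq_or_ne i j
    · simp
    · simpa [hij] using h i (by simpa [hij] using hi)
  simp only [cubeAvg, agree]

variable [Fintype ι]

theorem sum_sum_update {α : Type*} [Fintype α] (j : ι) (F : (ι → α) → ℝ) :
    ∑ u, ∑ v, F (update u j v) = Fintype.card α * ∑ u, F u := by
  have involutive : Function.Involutive fun p : (ι → α) × α => (update p.1 j p.2, p.1 j) := by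
    rintro ⟨u, v⟩
    simp
  have := Equiv.sum_comp involutive.toPerm fun p => F p.1
  simpa only [Function.Involutive.coe_toPerm, Fintype.sum_prod_type, Finset.sum_const,
    Finset.card_univ, nsmul_eq_mul, ← Finset.mul_sum] using this

theorem sum_zmod_two {M : Type*} [AddCommMonoid M] (φ : ZMod 2 → M) :
    ∑ b, φ b = φ 0 + φ 1 := Fin.sum_univ_two φ

theorem sum_eq_sum_update (j : ι) (F : (ι → ZMod 2) → ℝ) :
    ∑ u, F u = ∑ u, (F (update u j 0) + F (update u j 1)) / 2 := by
  have := sum_sum_update j F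
  rw [ZMod.card] at this
  simp only [sum_zmod_two] at this
  rw [← Finset.sum_div, this]
  simp

/-- The energy of a nonnegative function `f` in the direction `j`: a version of
`∑ u, |∇ⱼ f u| ^ 2 / f u` that bounds the entropy of `f` in the direction `j`. Division by zero
occurs where `f` vanishes on an edge, and the term of that edge is then `0` as it should be. -/
def cubeEnergy (j : ι) (f : (ι → ZMod 2) → ℝ) : ℝ :=
  ∑ u, (f (update u j 0) - f (update u j 1)) ^ 2 / (f (update u j 0) + f (update u j 1))

variable {f : (ι → ZMod 2) → ℝ}

theorem sum_cubeAvg (j : ι) : ∑ u, cubeAvg j f u = ∑ u, f u := (sum_eq_sum_update j f).symm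

theorem cubeEnergy_cubeAvg_le (hf : ∀ u, 0 ≤ f u) {i j : ι} (hij : i ≠ j) :
    cubeEnergy j (cubeAvg i f) ≤ cubeEnergy j f := by
  rw [cubeEnergy, cubeEnergy, sum_eq_sum_update i fun u => (f (update u j 0) - f (update u j 1)) ^ 2
    / (f (update u j 0) + f (update u j 1))]
  refine Finset.sum_le_sum fun u _ => ?_
  simp only [cubeAvg, Function.update_comm hij]
  refine le_trans (le_of_eq ?_) (div_le_div_of_nonneg_right
    (sq_sub_div_add_subadditive (hf _) (hf _) (hf _) (hf _)) zero_le_two)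
  have halve (a b c d : ℝ) : ((a + c) / 2 - (b + d) / 2) ^ 2 / ((a + c) / 2 + (b + d) / 2) =
      ((a + c) - (b + d)) ^ 2 / ((a + c) + (b + d)) / 2 := by
    rw [← sub_div, ← add_div, div_pow, div_div_div_eq, div_div, mul_comm (_ ^ 2) (2 : ℝ),
      pow_two (2 : ℝ), mul_assoc, mul_div_mul_left _ _ two_ne_zero, mul_comm (2 : ℝ)]
  exact halve ..

theorem sum_mul_log_sub_sum_cubeAvg_mul_log_le (hf : ∀ u, 0 ≤ f u) (j : ι) :
    ∑ u, f u * Real.log (f u) - ∑ u, cubeAvg j f u * Real.log (cubeAvg j f u) ≤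
      cubeEnergy j f / 2 := by
  rw [sum_eq_sum_update j fun u => f u * Real.log (f u), ← Finset.sum_sub_distrib, cubeEnergy,
    Finset.sum_div]
  gcongr with u
  have := mul_log_add_mul_log_le (hf (update u j 0)) (hf (update u j 1))
  rw [cubeAvg]
  linarith

theorem sum_mul_log_le_sum_cubeEnergy (hf : ∀ u, 0 ≤ f u) :
    ∑ u, f u * Real.log (f u) ≤
      (∑ u, f u) * Real.log ((∑ u, f u) / 2 ^ Fintype.card ι) + (∑ j, cubeEnergy j f) / 2 := by
  suffices ∀ (s : Finset ι) (f : (ι → ZMod 2) → ℝ), (∀ u, 0 ≤ f u) → DependsOn f s →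
      ∑ u, f u * Real.log (f u) ≤
        (∑ u, f u) * Real.log ((∑ u, f u) / 2 ^ Fintype.card ι) + (∑ j ∈ s, cubeEnergy j f) / 2 from
    this Finset.univ f hf (by simpa using dependsOn_univ f)
  intro s
  induction s using Finset.induction_on with
  | empty =>
    intro f _ hf
    have eq_const (u) : f u = f 0 := hf (by simp)
    simp [eq_const, mul_assoc]
  | insert j s hj ih =>
    intro f hf hs
    have after := ih (cubeAvg j f) (fun u => div_nonneg (add_nonneg (hf _) (hf _)) zero_le_two)
      (dependsOn_cubeAvg hs)
    rw [sum_cubeAvg] at after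
    have drop := sum_mul_log_sub_sum_cubeAvg_mul_log_le hf j
    have energy_le : ∑ i ∈ s, cubeEnergy i (cubeAvg j f) ≤ ∑ i ∈ s, cubeEnergy i f :=
      Finset.sum_le_sum fun i hi => cubeEnergy_cubeAvg_le hf (ne_of_mem_of_not_mem hi hj).symm
    rw [Finset.sum_insert hj]
    linarith

end Cube

/-! ### The capacity of a symmetric channel -/

section Capacity

open InformationTheory ProbabilityTheory

open scoped ENNReal

theorem klDiv_fst_prod_snd_le {α β : Type*} [MeasurableSpace α] [StandardBorelSpace α]
    [Nonempty α] [MeasurableSpace β] (μ : Measure (α × β)) [IsProbabilityMeasure μ]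
    (Q : Measure β) [IsFiniteMeasure Q] :
    klDiv μ (μ.fst.prod μ.snd) ≤ klDiv μ (μ.fst.prod Q) := by
  set μ' := μ.map Prod.swap with hμ'
  have : IsProbabilityMeasure μ' := Measure.isProbabilityMeasure_map measurable_swap.aemeasurable
  have hswap (Q' : Measure β) [IsFiniteMeasure Q'] :
      klDiv μ (μ.fst.prod Q') = klDiv μ' (Q'.prod μ.fst) := by
    refine le_antisymm ?_ ?_
    · simpa [hμ', Measure.map_map measurable_swap measurable_swap, Measure.prod_swap] using
        klDiv_map_le μ' (Q'.prod μ.fst) measurable_swap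
    · simpa [hμ', Measure.prod_swap] using
        klDiv_map_le μ (μ.fst.prod Q') measurable_swap
  have hfst : μ'.fst = μ.snd := Measure.fst_map_swap
  rw [hswap, hswap, ← μ'.disintegrate μ'.condKernel, hfst, ← Measure.compProd_const,
    ← Measure.compProd_const, klDiv_compProd_eq_add μ.snd Q μ'.condKernel]
  exact le_add_self

theorem klDiv_withDensity_self {α : Type*} [MeasurableSpace α] (μ : Measure α) [IsFiniteMeasure μ]
    {f : α → ℝ≥0∞} [IsFiniteMeasure (μ.withDensity f)] (hf : Measurable f) :
    klDiv (μ.withDensity f) μ = ∫⁻ x, ENNReal.ofReal (klFun (f x).toReal) ∂μ := by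
  rw [klDiv_eq_lintegral_klFun_of_ac (withDensity_absolutelyContinuous _ _)]
  refine lintegral_congr_ae ?_
  filter_upwards [Measure.rnDeriv_withDensity μ hf] with x hx
  rw [hx]

theorem transition_nonneg (x : ZMod 2) (y : ChannelSymbol) : 0 ≤ transition x y := by
  have h := y.1.2
  unfold transition
  split_ifs <;> linarith [h.1, h.2]

theorem transition_le_one (x : ZMod 2) (y : ChannelSymbol) : transition x y ≤ 1 := by
  have h := y.1.2
  unfold transition
  split_ifs <;> linarith [h.1, h.2]

theorem transition_channelOutput (x b : ZMod 2) (y : ChannelSymbol) :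
    transition (x + b) (channelOutput x y) = transition b y := by
  simp [transition, channelOutput]

theorem sum_comp_transition {M : Type*} [AddCommMonoid M] (g : ℝ → M) (x : ZMod 2)
    (e : Crossover) : ∑ u, g (transition x (e, u)) = g e + g (1 - e) := by
  rw [← Equiv.sum_comp (Equiv.addLeft x), sum_zmod_two]
  simp [transition, add_comm]

theorem sum_transition (x : ZMod 2) (e : Crossover) : ∑ u, transition x (e, u) = 1 :=
  (sum_comp_transition id x e).trans (by simp)

theorem measurable_transition :
    Measurable fun q : ZMod 2 × ChannelSymbol => transition q.1 q.2 := by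
  unfold transition
  exact Measurable.ite (measurableSet_eq_fun (by fun_prop) (by fun_prop)) (by fun_prop)
    (by fun_prop)

theorem measurable_transition_right (x : ZMod 2) : Measurable (transition x) :=
  measurable_transition.comp measurable_prodMk_left

theorem measurable_channelOutput :
    Measurable fun q : ZMod 2 × ChannelSymbol => channelOutput q.1 q.2 := by
  unfold channelOutput
  exact .prodMk (by fun_prop) ((measurable_of_finite fun q : ZMod 2 × ZMod 2 => q.1 + q.2).comp
    (f := fun q : ZMod 2 × ChannelSymbol => (q.1, q.2.2)) (by fun_prop))

theorem measurable_channelOutput_right (x : ZMod 2) : Measurable (channelOutput x) :=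
  measurable_channelOutput.comp measurable_prodMk_left

theorem integrable_binEntropy (ν : Measure Crossover) [IsFiniteMeasure ν] :
    Integrable (fun e : Crossover => Real.binEntropy e) ν :=
  (Real.binEntropy_continuous.comp continuous_subtype_val).integrable_of_hasCompactSupport
    (HasCompactSupport.of_compactSpace _)

theorem lintegral_prod_count {α β : Type*} [MeasurableSpace α] [MeasurableSpace β] [Fintype β]
    [MeasurableSingletonClass β] (ν : Measure α) {F : α × β → ℝ≥0∞} (hF : Measurable F) :
    ∫⁻ y, F y ∂(ν.prod Measure.count) = ∫⁻ e, ∑ u, F (e, u) ∂ν := by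
  rw [lintegral_prod _ hF.aemeasurable]
  simp [lintegral_count]

theorem map_channelOutput (ν : Measure Crossover) [SFinite ν] (x : ZMod 2) :
    (noiseLaw ν).map (channelOutput x) =
      (ν.prod Measure.count).withDensity fun y => ENNReal.ofReal (transition x y) := by
  have h0 := (measurable_transition_right 0).ennreal_ofReal
  have hx := (measurable_transition_right x).ennreal_ofReal
  have hout := measurable_channelOutput_right x
  refine Measure.ext_of_lintegral _ fun F hF => ?_
  have hFout : Measurable fun z => F (channelOutput x z) := hF.comp hout
  rw [lintegral_map hF hout, noiseLaw, lintegral_withDensity_eq_lintegral_mul _ h0 hFout,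
    lintegral_withDensity_eq_lintegral_mul _ hx hF, lintegral_prod_count _ (h0.mul hFout),
    lintegral_prod_count _ (hx.mul hF)]
  refine lintegral_congr fun e => ?_
  refine Fintype.sum_equiv (Equiv.addLeft x) _ _ fun u => ?_
  have h := transition_channelOutput x 0 (e, u)
  simp only [add_zero, channelOutput] at h
  simp [channelOutput, h]

variable (ν : Measure Crossover) [IsProbabilityMeasure ν]

instance isProbabilityMeasure_noiseLaw : IsProbabilityMeasure (noiseLaw ν) := by
  constructor
  rw [noiseLaw, withDensity_apply _ .univ, Measure.restrict_univ,
    lintegral_prod_count _ (measurable_transition_right 0).ennreal_ofReal]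
  simp [← ENNReal.ofReal_sum_of_nonneg fun _ _ => transition_nonneg _ _, sum_transition]

theorem inputOutputLaw_eq_withDensity (p : Measure (ZMod 2)) [SFinite p] : inputOutputLaw ν p =
    (p.prod (ν.prod Measure.count)).withDensity
      fun q => ENNReal.ofReal (transition q.1 q.2) := by
  have ht := measurable_transition.ennreal_ofReal
  have hout := measurable_fst.prodMk measurable_channelOutput
  refine Measure.ext_of_lintegral _ fun F hF => ?_
  have hFout : Measurable fun q : ZMod 2 × ChannelSymbol => F (q.1, channelOutput q.1 q.2) :=
    hF.comp hout
  rw [inputOutputLaw, lintegral_map hF hout, lintegral_withDensity_eq_lintegral_mul _ ht hF,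
    lintegral_prod _ hFout.aemeasurable, lintegral_prod _ (ht.mul hF).aemeasurable]
  refine lintegral_congr fun x => ?_
  have hFx : Measurable fun y => F (x, y) := hF.comp measurable_prodMk_left
  rw [← lintegral_map (μ := noiseLaw ν) hFx (measurable_channelOutput_right x), map_channelOutput,
    lintegral_withDensity_eq_lintegral_mul _ (measurable_transition_right x).ennreal_ofReal hFx]
  rfl

instance isProbabilityMeasure_inputOutputLaw (p : Measure (ZMod 2)) [IsProbabilityMeasure p] :
    IsProbabilityMeasure (inputOutputLaw ν p) :=
  Measure.isProbabilityMeasure_map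
    (measurable_fst.prodMk measurable_channelOutput).aemeasurable

theorem fst_inputOutputLaw (p : Measure (ZMod 2)) : (inputOutputLaw ν p).fst = p := by
  rw [inputOutputLaw, Measure.fst, Measure.map_map measurable_fst
    (measurable_fst.prodMk measurable_channelOutput)]
  exact Measure.fst_prod

theorem half_sum_klFun_transition (x : ZMod 2) (e : Crossover) :
    2⁻¹ * ∑ u, klFun (2 * transition x (e, u)) = Real.log 2 - Real.binEntropy e := by
  have hlog (t : ℝ) : klFun (2 * t) = 2 * t * Real.log 2 + 2 * (t * Real.log t) + 1 - 2 * t := by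
    rcases eq_or_ne t 0 with rfl | ht
    · simp [klFun]
    · rw [klFun, Real.log_mul two_ne_zero ht]
      ring
  rw [sum_comp_transition fun t => klFun (2 * t), hlog, hlog,
    Real.binEntropy_eq_negMulLog_add_negMulLog_one_sub, Real.negMulLog, Real.negMulLog]
  ring

/-- The law of the channel output when the input is uniform on `ZMod 2`. -/
def uniformInputOutput : Measure ChannelSymbol :=
  (2 : ℝ≥0∞)⁻¹ • ν.prod Measure.count

instance isFiniteMeasure_uniformInputOutput : IsFiniteMeasure (uniformInputOutput ν) :=
  Measure.smul_finite _ (by simp)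

theorem inputOutputLaw_eq_withDensity_uniformInputOutput (p : Measure (ZMod 2)) [SFinite p] :
    inputOutputLaw ν p = (p.prod (uniformInputOutput ν)).withDensity
      fun q => ENNReal.ofReal (2 * transition q.1 q.2) := by
  have ht := measurable_transition.ennreal_ofReal
  simp only [ENNReal.ofReal_mul zero_le_two, ENNReal.ofReal_ofNat]
  rw [inputOutputLaw_eq_withDensity, uniformInputOutput, Measure.prod_smul_right,
    withDensity_smul_measure,
    show (fun q : ZMod 2 × ChannelSymbol => 2 * ENNReal.ofReal (transition q.1 q.2)) =
      (2 : ℝ≥0∞) • fun q => ENNReal.ofReal (transition q.1 q.2) from rfl,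
    withDensity_smul _ ht, smul_smul, ENNReal.inv_mul_cancel two_ne_zero ENNReal.ofNat_ne_top,
    one_smul]

theorem lintegral_klFun_transition_uniformInputOutput (x : ZMod 2) :
    ∫⁻ y, ENNReal.ofReal (klFun (2 * transition x y)) ∂uniformInputOutput ν =
      ENNReal.ofReal (Real.log 2 - ∫ e : Crossover, Real.binEntropy e ∂ν) := by
  have hm : Measurable fun y => ENNReal.ofReal (klFun (2 * transition x y)) :=
    (measurable_klFun.comp ((measurable_transition_right x).const_mul 2)).ennreal_ofReal
  have hint : ∫ e : Crossover, (Real.log 2 - Real.binEntropy e) ∂ν =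
      Real.log 2 - ∫ e : Crossover, Real.binEntropy e ∂ν := by
    rw [integral_sub (integrable_const _) (integrable_binEntropy ν)]
    simp
  calc ∫⁻ y, ENNReal.ofReal (klFun (2 * transition x y)) ∂uniformInputOutput ν
      = ∫⁻ e, ENNReal.ofReal (Real.log 2 - Real.binEntropy (e : ℝ)) ∂ν := by
        rw [uniformInputOutput, lintegral_smul_measure, lintegral_prod_count _ hm, smul_eq_mul,
          ← lintegral_const_mul' _ _ (by simp)]
        refine lintegral_congr fun e => ?_
        rw [← half_sum_klFun_transition x e, ENNReal.ofReal_mul (by norm_num),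
          ENNReal.ofReal_sum_of_nonneg fun u _ =>
            klFun_nonneg (mul_nonneg zero_le_two (transition_nonneg x (e, u)))]
        simp [ENNReal.ofReal_inv_of_pos]
    _ = ENNReal.ofReal (∫ e : Crossover, (Real.log 2 - Real.binEntropy e) ∂ν) :=
        (ofReal_integral_eq_lintegral_ofReal
          ((integrable_const _).sub (integrable_binEntropy ν))
          (ae_of_all _ fun e => sub_nonneg.2 Real.binEntropy_le_log_two)).symm
    _ = _ := by rw [hint]

theorem klDiv_inputOutputLaw_prod_uniformInputOutput (p : Measure (ZMod 2))
    [IsProbabilityMeasure p] :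
    klDiv (inputOutputLaw ν p) (p.prod (uniformInputOutput ν)) =
      ENNReal.ofReal (Real.log 2 - ∫ e : Crossover, Real.binEntropy e ∂ν) := by
  have hm := measurable_transition.const_mul 2
  have hdens := inputOutputLaw_eq_withDensity_uniformInputOutput ν p
  have : IsFiniteMeasure ((p.prod (uniformInputOutput ν)).withDensity
    fun q => ENNReal.ofReal (2 * transition q.1 q.2)) := hdens ▸ inferInstance
  have htoReal (q : ZMod 2 × ChannelSymbol) :
      (ENNReal.ofReal (2 * transition q.1 q.2)).toReal = 2 * transition q.1 q.2 :=
    ENNReal.toReal_ofReal (mul_nonneg zero_le_two (transition_nonneg q.1 q.2))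
  rw [hdens, klDiv_withDensity_self _ hm.ennreal_ofReal]
  simp only [htoReal]
  have hkm : Measurable fun q : ZMod 2 × ChannelSymbol =>
      ENNReal.ofReal (klFun (2 * transition q.1 q.2)) := (measurable_klFun.comp hm).ennreal_ofReal
  rw [lintegral_prod _ hkm.aemeasurable]
  simp [lintegral_klFun_transition_uniformInputOutput]

theorem klDiv_inputOutputLaw_le (p : Measure (ZMod 2)) [IsProbabilityMeasure p] :
    klDiv (inputOutputLaw ν p) ((inputOutputLaw ν p).fst.prod (inputOutputLaw ν p).snd) ≤
      ENNReal.ofReal (Real.log 2 - ∫ e : Crossover, Real.binEntropy e ∂ν) := by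
  rw [← klDiv_inputOutputLaw_prod_uniformInputOutput ν p]
  simpa only [fst_inputOutputLaw] using
    klDiv_fst_prod_snd_le (inputOutputLaw ν p) (uniformInputOutput ν)

theorem capacity_mul_log_two_le :
    capacity ν * Real.log 2 ≤ Real.log 2 - ∫ e : Crossover, Real.binEntropy e ∂ν := by
  have hle : ∫ e : Crossover, Real.binEntropy e ∂ν ≤ Real.log 2 := by
    simpa using integral_mono (integrable_binEntropy ν) (integrable_const (Real.log 2))
      fun e => Real.binEntropy_le_log_two
  rw [capacity, div_mul_cancel₀ _ (Real.log_pos one_lt_two).ne']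
  exact ENNReal.toReal_le_of_le_ofReal (sub_nonneg.2 hle)
    (iSup_le fun p => klDiv_inputOutputLaw_le ν p)

end Capacity

/-! ### Reed–Muller codes -/

section ReedMuller

theorem mem_reedMuller {m r : ℕ} {c : (Fin m → ZMod 2) → ZMod 2} :
    c ∈ reedMuller m r ↔ ∃ P : MvPolynomial (Fin m) (ZMod 2), P.totalDegree ≤ r ∧
      ∀ v, MvPolynomial.eval v P = c v := by
  simp only [reedMuller, Submodule.mem_map, MvPolynomial.mem_restrictTotalDegree]
  refine exists_congr fun P => and_congr_right fun _ => ?_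
  exact funext_iff

theorem totalDegree_bind₁_le {σ τ R : Type*} [CommSemiring R] {n : ℕ}
    {L : σ → MvPolynomial τ R} (hL : ∀ i, (L i).totalDegree ≤ n) (P : MvPolynomial σ R) :
    (MvPolynomial.bind₁ L P).totalDegree ≤ P.totalDegree * n := by
  rw [MvPolynomial.bind₁, MvPolynomial.aeval_def, MvPolynomial.eval₂_eq]
  refine MvPolynomial.totalDegree_finsetSum_le fun d hd => ?_
  calc _ ≤ (∏ i ∈ d.support, L i ^ d i).totalDegree := by
        refine (MvPolynomial.totalDegree_mul _ _).trans ?_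
        rw [MvPolynomial.algebraMap_eq, MvPolynomial.totalDegree_C, zero_add]
    _ ≤ ∑ i ∈ d.support, (L i ^ d i).totalDegree := MvPolynomial.totalDegree_finsetProd _ _
    _ ≤ ∑ i ∈ d.support, d i * n := by
        gcongr with i
        exact (MvPolynomial.totalDegree_pow _ _).trans (Nat.mul_le_mul_left _ (hL i))
    _ ≤ P.totalDegree * n := by
        rw [← Finset.sum_mul]
        exact Nat.mul_le_mul_right n (MvPolynomial.le_totalDegree hd)

theorem comp_affineMap_mem_reedMuller {m m' r : ℕ} {c : (Fin m → ZMod 2) → ZMod 2}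
    (hc : c ∈ reedMuller m r) (φ : (Fin m' → ZMod 2) →ᵃ[ZMod 2] (Fin m → ZMod 2)) :
    c ∘ φ ∈ reedMuller m' r := by
  obtain ⟨P, hP, hPc⟩ := mem_reedMuller.1 hc
  set L : Fin m → MvPolynomial (Fin m') (ZMod 2) := fun i =>
    ∑ k, MvPolynomial.C (φ.linear (fun l => if k = l then 1 else 0) i) * MvPolynomial.X k +
      MvPolynomial.C (φ 0 i) with hL
  have hdeg (i : Fin m) : (L i).totalDegree ≤ 1 := by
    refine (MvPolynomial.totalDegree_add _ _).trans (max_le ?_ (by simp))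
    refine MvPolynomial.totalDegree_finsetSum_le fun k _ => ?_
    exact (MvPolynomial.totalDegree_mul _ _).trans (by simp)
  have heval (v : Fin m' → ZMod 2) : (fun i => MvPolynomial.eval v (L i)) = φ v := by
    ext i
    rw [φ.decomp, Pi.add_apply, Pi.add_apply, φ.linear.pi_apply_eq_sum_univ v]
    simp [hL, mul_comm]
  refine mem_reedMuller.2 ⟨MvPolynomial.bind₁ L P,
    (totalDegree_bind₁_le hdeg P).trans (by simpa using hP), fun v => ?_⟩
  have h := MvPolynomial.aeval_bind₁ (S := ZMod 2) v L P
  simp only [MvPolynomial.aeval_eq_eval] at h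
  rw [Function.comp_apply, ← heval, ← hPc]
  exact h

/-- The exponents of the squarefree monomials of degree at most `r`. Over `ZMod 2` a monomial and
its squarefree part define the same function. -/
def squarefreeExponents (m r : ℕ) : Set (Fin m →₀ ℕ) :=
  {d | (∀ i, d i ≤ 1) ∧ #d.support ≤ r}

/-- The bijection of squarefree exponents with their sets of variables. -/
def squarefreeExponentsEquiv (m r : ℕ) :
    squarefreeExponents m r ≃ {s : Finset (Fin m) // #s ≤ r} where
  toFun d := ⟨d.1.support, d.2.2⟩
  invFun s := ⟨Finsupp.indicator s.1 fun _ _ => 1, by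
    refine ⟨fun i => ?_, (Finset.card_le_card (Finsupp.support_indicator_subset _ _)).trans s.2⟩
    rw [Finsupp.indicator_apply]
    split_ifs <;> simp⟩
  left_inv d := by
    ext i
    have := d.2.1 i
    simp only [Finsupp.indicator_apply, Finsupp.mem_support_iff]
    split_ifs <;> omega
  right_inv s := by
    ext i
    simp [Finsupp.indicator_apply]

theorem card_finset_card_le (m r : ℕ) :
    #{s : Finset (Fin m) | #s ≤ r} = ∑ i ∈ Finset.range (r + 1), m.choose i := by
  rw [Finset.card_eq_sum_card_fiberwise (f := Finset.card) (t := Finset.range (r + 1))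
    fun s hs => by simpa [Nat.lt_succ_iff] using hs]
  refine Finset.sum_congr rfl fun i hi => ?_
  have hfiber : {s ∈ ({s | #s ≤ r} : Finset (Finset (Fin m))) | #s = i} =
      Finset.powersetCard i Finset.univ := by
    ext s
    have := Finset.mem_range.1 hi
    simp only [Finset.mem_filter, Finset.mem_univ, true_and, Finset.mem_powersetCard,
      Finset.subset_univ]
    lia
  rw [hfiber, Finset.card_powersetCard, Finset.card_univ, Fintype.card_fin]

theorem natCard_squarefreeExponents (m r : ℕ) :
    Nat.card (squarefreeExponents m r) = ∑ i ∈ Finset.range (r + 1), m.choose i := by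
  rw [Nat.card_congr (squarefreeExponentsEquiv m r), Nat.card_eq_fintype_card,
    Fintype.card_subtype, card_finset_card_le]

theorem reedMuller_eq_map_squarefree (m r : ℕ) : reedMuller m r =
    (MvPolynomial.restrictSupport (ZMod 2) (squarefreeExponents m r)).map
      (MvPolynomial.evalₗ (ZMod 2) (Fin m)) := by
  have hcard (d : Fin m →₀ ℕ) : #d.support ≤ d.sum fun _ e => e := by
    rw [Finsupp.sum, Finset.card_eq_sum_ones]
    exact Finset.sum_le_sum fun i hi => Nat.one_le_iff_ne_zero.2 (Finsupp.mem_support_iff.1 hi)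
  apply le_antisymm
  · rw [reedMuller, MvPolynomial.restrictTotalDegree, MvPolynomial.restrictSupport_eq_span,
      Submodule.map_span, Submodule.span_le]
    rintro _ ⟨_, ⟨d, hd, rfl⟩, rfl⟩
    have hd' : #d.support ≤ r := (hcard d).trans hd
    refine ⟨MvPolynomial.monomial ((squarefreeExponentsEquiv m r).symm ⟨d.support, hd'⟩).1 1,
      (MvPolynomial.monomial_mem_restrictSupport _).2 (Or.inl (Subtype.coe_prop _)), ?_⟩
    ext v
    simp only [MvPolynomial.evalₗ_apply, MvPolynomial.eval_monomial, one_mul]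
    rw [Finsupp.prod_fintype _ _ (by simp), Finsupp.prod_fintype _ _ (by simp)]
    refine Finset.prod_congr rfl fun i _ => ?_
    have hv : v i = 0 ∨ v i = 1 := by generalize v i = x; decide +revert
    rcases hv with h | h <;>
      simp [h, squarefreeExponentsEquiv, Finsupp.indicator_apply, zero_pow_eq]
  · rw [reedMuller]
    refine Submodule.map_mono (MvPolynomial.restrictSupport_mono _ fun d hd => ?_)
    refine le_trans (Finset.sum_le_card_nsmul _ _ 1 fun i _ => hd.1 i) ?_
    simpa using hd.2

theorem finrank_reedMuller (m r : ℕ) :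
    Module.finrank (ZMod 2) (reedMuller m r) = ∑ i ∈ Finset.range (r + 1), m.choose i := by
  rw [reedMuller_eq_map_squarefree, ← LinearMap.range_domRestrict, LinearMap.finrank_range_of_inj,
    Module.finrank_eq_nat_card_basis (MvPolynomial.basisRestrictSupport _ _),
    natCard_squarefreeExponents]
  rw [← LinearMap.ker_eq_bot, LinearMap.ker_eq_bot']
  intro P hP
  refine Subtype.ext (MvPolynomial.eq_zero_of_eval_eq_zero _ _ P.1 (fun v => congr_fun hP v) ?_)
  exact MvPolynomial.restrictSupport_mono _ (fun d hd i => by simpa using hd.1 i) P.2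

theorem centralBinom_sq_mul_le (n : ℕ) : n.centralBinom ^ 2 * (2 * n + 1) ≤ 16 ^ n := by
  induction n with
  | zero => simp
  | succ n ih =>
    have h := Nat.succ_mul_centralBinom_succ n
    have hpos : 0 < (n + 1) ^ 2 := by positivity
    refine Nat.le_of_mul_le_mul_left ?_ hpos
    calc (n + 1) ^ 2 * ((n + 1).centralBinom ^ 2 * (2 * (n + 1) + 1))
        = ((n + 1) * (n + 1).centralBinom) ^ 2 * (2 * n + 3) := by ring
      _ = (n.centralBinom ^ 2 * (2 * n + 1)) * (4 * ((2 * n + 1) * (2 * n + 3))) := by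
          rw [h]; ring
      _ ≤ 16 ^ n * (4 * (4 * (n + 1) ^ 2)) := by
          refine Nat.mul_le_mul ih (Nat.mul_le_mul_left 4 ?_)
          nlinarith
      _ = (n + 1) ^ 2 * 16 ^ (n + 1) := by ring

theorem choose_two_mul_mul_sqrt_le (n r : ℕ) :
    ((2 * n).choose r : ℝ) * √(2 * n + 1) ≤ 4 ^ n := by
  have hchoose : ((2 * n).choose r : ℝ) ≤ n.centralBinom :=
    mod_cast Nat.choose_le_centralBinom r n
  have hsq : (n.centralBinom : ℝ) ^ 2 * (2 * n + 1) ≤ 16 ^ n :=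
    mod_cast centralBinom_sq_mul_le n
  calc ((2 * n).choose r : ℝ) * √(2 * n + 1)
      ≤ n.centralBinom * √(2 * n + 1) := by gcongr
    _ = √(n.centralBinom ^ 2 * (2 * n + 1)) := by
        rw [Real.sqrt_mul (by positivity), Real.sqrt_sq (by positivity)]
    _ ≤ √((4 ^ n) ^ 2) := Real.sqrt_le_sqrt (by rw [pow_right_comm]; norm_num [hsq])
    _ = 4 ^ n := Real.sqrt_sq (by positivity)

theorem choose_mul_sqrt_le (m r : ℕ) : (m.choose r : ℝ) * √m ≤ 2 ^ m := by
  obtain ⟨n, rfl | rfl⟩ := Nat.even_or_odd' m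
  · calc ((2 * n).choose r : ℝ) * √((2 * n : ℕ) : ℝ)
        ≤ (2 * n).choose r * √(2 * n + 1) := by gcongr; push_cast; linarith
      _ ≤ 4 ^ n := choose_two_mul_mul_sqrt_le n r
      _ = 2 ^ (2 * n) := by rw [pow_mul]; norm_num
  · have hpascal : ((2 * n + 1).choose r : ℝ) * √(2 * n + 1) ≤ 2 * 4 ^ n := by
      cases r with
      | zero =>
        have h := choose_two_mul_mul_sqrt_le n 0
        have : (0 : ℝ) ≤ 4 ^ n := by positivity
        simp only [Nat.choose_zero_right] at h ⊢
        linarith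
      | succ r =>
        rw [Nat.choose_succ_succ]
        push_cast
        linarith [choose_two_mul_mul_sqrt_le n r, choose_two_mul_mul_sqrt_le n (r + 1)]
    calc ((2 * n + 1).choose r : ℝ) * √((2 * n + 1 : ℕ) : ℝ)
        ≤ 2 * 4 ^ n := by exact_mod_cast hpascal
      _ = 2 ^ (2 * n + 1) := by rw [pow_succ, pow_mul]; norm_num [mul_comm]

theorem codeRate_reedMuller (m r : ℕ) :
    codeRate (reedMuller m r) = (∑ i ∈ Finset.range (r + 1), (m.choose i : ℝ)) / 2 ^ m := by
  rw [codeRate, finrank_reedMuller]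
  simp

theorem codeRate_reedMuller_succ (m r : ℕ) :
    codeRate (reedMuller m r) = codeRate (reedMuller (m + 1) r) + m.choose r / 2 ^ (m + 1) := by
  have h : ∑ i ∈ Finset.range (r + 1), ((m + 1).choose i : ℝ) + m.choose r =
      2 * ∑ i ∈ Finset.range (r + 1), (m.choose i : ℝ) := by
    rw [Finset.sum_range_succ', Finset.sum_congr rfl fun i _ => by
      rw [Nat.choose_succ_succ, Nat.cast_add], Finset.sum_add_distrib]
    have h1 := Finset.sum_range_succ (fun i => (m.choose i : ℝ)) r
    have h2 := Finset.sum_range_succ' (fun i => (m.choose i : ℝ)) r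
    simp only [Nat.choose_zero_right] at h2 ⊢
    linarith
  rw [codeRate_reedMuller, codeRate_reedMuller, ← add_div, h, pow_succ]
  field_simp

theorem codeRate_reedMuller_sub_le {m l : ℕ} (r : ℕ) (hl : 2 * l ≤ m) (hm : 0 < m) :
    codeRate (reedMuller (m - l) r) ≤ codeRate (reedMuller m r) + l / √m := by
  have hsm : 0 < √(m : ℝ) := Real.sqrt_pos.2 (mod_cast hm)
  induction l with
  | zero => simp
  | succ l ih =>
    obtain ⟨n, hn⟩ : ∃ n, m - l = n + 1 := ⟨m - (l + 1), by omega⟩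
    have hsqrt : √(m : ℝ) ≤ 2 * √(n : ℝ) := by
      calc √(m : ℝ) ≤ √(2 ^ 2 * n) := Real.sqrt_le_sqrt (by norm_cast; omega)
        _ = 2 * √(n : ℝ) := by rw [Real.sqrt_mul (by positivity), Real.sqrt_sq zero_le_two]
    have hstep : (n.choose r : ℝ) / 2 ^ (n + 1) ≤ 1 / √m := by
      rw [div_le_div_iff₀ (by positivity) hsm, one_mul]
      calc (n.choose r : ℝ) * √m ≤ n.choose r * (2 * √n) := by gcongr
        _ = 2 * (n.choose r * √n) := by ring
        _ ≤ 2 * 2 ^ n := by gcongr; exact choose_mul_sqrt_le n r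
        _ = 2 ^ (n + 1) := by ring
    calc codeRate (reedMuller (m - (l + 1)) r)
        = codeRate (reedMuller (m - l) r) + n.choose r / 2 ^ (n + 1) := by
          rw [hn, show m - (l + 1) = n by omega, codeRate_reedMuller_succ]
      _ ≤ codeRate (reedMuller m r) + l / √m + 1 / √m := add_le_add (ih (by omega)) hstep
      _ = codeRate (reedMuller m r) + (l + 1 : ℕ) / √m := by push_cast; ring

end ReedMuller

/-! ### Transmission of a codeword -/

section Transmission

open scoped ENNReal

theorem isBddMeasurable_indicator_one {Ω : Type*} [MeasurableSpace Ω] {S : Set Ω}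
    (hS : MeasurableSet S) : IsBddMeasurable (S.indicator (1 : Ω → ℝ)) :=
  ⟨measurable_one.indicator hS, 1, fun z => by
    by_cases h : z ∈ S <;> simp [h]⟩

theorem pi_withDensity_prod_count {ι α β : Type*} [Fintype ι] [MeasurableSpace α]
    [MeasurableSpace β] [Finite β] [MeasurableSingletonClass β] (ν : Measure α)
    [IsProbabilityMeasure ν] {g : ι → α × β → ℝ≥0∞} (hg : ∀ j, Measurable (g j))
    [∀ j, SigmaFinite ((ν.prod Measure.count).withDensity (g j))] :
    Measure.pi (fun j => (ν.prod Measure.count).withDensity (g j)) =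
      (((Measure.pi fun _ => ν).prod Measure.count).withDensity fun p : (ι → α) × (ι → β) =>
        ∏ j, g j (p.1 j, p.2 j)).map fun p j => (p.1 j, p.2 j) := by
  classical
  have := Fintype.ofFinite β
  refine Measure.pi_eq fun s hs => ?_
  have hzip : Measurable fun (p : (ι → α) × (ι → β)) j => (p.1 j, p.2 j) := by fun_prop
  have hbox := MeasurableSet.univ_pi hs
  have hG (j : ι) : Measurable ((s j).indicator (g j)) := (hg j).indicator (hs j)
  have hGu (j : ι) (v : β) : Measurable fun x => (s j).indicator (g j) (x, v) := by fun_prop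
  have indicator_box : ((fun (p : (ι → α) × (ι → β)) j => (p.1 j, p.2 j)) ⁻¹'
      Set.univ.pi s).indicator (fun p => ∏ j, g j (p.1 j, p.2 j)) =
      fun p => ∏ j, (s j).indicator (g j) (p.1 j, p.2 j) := by
    ext p
    simp only [Set.indicator_apply, Set.mem_preimage, Set.mem_univ_pi, Finset.prod_ite_zero,
      Finset.mem_univ, true_imp_iff]
  have factor (u : ι → β) : ∫⁻ e, ∏ j, (s j).indicator (g j) (e j, u j) ∂(Measure.pi fun _ => ν) =
      ∏ j, ∫⁻ x, (s j).indicator (g j) (x, u j) ∂ν := by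
    rw [ProbabilityTheory.lintegral_prod_eq_prod_lintegral_of_indepFun Finset.univ _
      (ProbabilityTheory.iIndepFun_pi fun j => (hGu j _).aemeasurable) (by fun_prop)]
    exact Finset.prod_congr rfl fun j _ =>
      (measurePreserving_eval (fun _ : ι => ν) j).lintegral_comp (hGu j _)
  rw [Measure.map_apply hzip hbox, withDensity_apply _ (hzip hbox),
    ← lintegral_indicator (hzip hbox), indicator_box, lintegral_prod_count _ (by fun_prop),
    lintegral_finsetSum _ (by fun_prop)]
  simp only [factor, withDensity_apply _ (hs _), ← lintegral_indicator (hs _),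
    lintegral_prod_count _ (hG _), lintegral_finsetSum _ fun v _ => hGu _ v,
    Finset.prod_univ_sum, Fintype.piFinset_univ]

variable {ι : Type}

/-- The output of the memoryless channel on input `c` under the noise `z`. -/
def wordOutput (c : ι → ZMod 2) (z : ι → ChannelSymbol) : ι → ChannelSymbol :=
  fun j => channelOutput (c j) (z j)

/-- The output with crossover probabilities `e` and received bits `u`. -/
def outputOf (e : ι → Crossover) (u : ι → ZMod 2) : ι → ChannelSymbol := fun j => (e j, u j)

theorem measurable_wordOutput (c : ι → ZMod 2) : Measurable (wordOutput c) :=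
  measurable_pi_lambda _ fun j =>
    (measurable_channelOutput_right (c j)).comp (measurable_pi_apply j)

theorem measurable_outputOf (u : ι → ZMod 2) :
    Measurable fun e : ι → Crossover => outputOf e u :=
  measurable_pi_lambda _ fun j => (measurable_pi_apply j).prodMk measurable_const

variable [Fintype ι]

/-- The likelihood of the word `c` given the output `y`. -/
def wordLikelihood (c : ι → ZMod 2) (y : ι → ChannelSymbol) : ℝ :=
  ∏ j, transition (c j) (y j)

theorem wordLikelihood_nonneg (c : ι → ZMod 2) (y : ι → ChannelSymbol) : 0 ≤ wordLikelihood c y :=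
  Finset.prod_nonneg fun _ _ => transition_nonneg _ _

theorem isBddMeasurable_wordLikelihood (c : ι → ZMod 2) : IsBddMeasurable (wordLikelihood c) :=
  ⟨Finset.measurable_fun_prod _ fun j _ =>
    (measurable_transition_right (c j)).comp (measurable_pi_apply j), 1, fun y => by
      rw [abs_of_nonneg (wordLikelihood_nonneg c y)]
      exact Finset.prod_le_one (fun _ _ => transition_nonneg _ _) fun _ _ => transition_le_one _ _⟩

variable (ν : Measure Crossover) [IsProbabilityMeasure ν]

theorem map_wordOutput (c : ι → ZMod 2) :
    (Measure.pi fun _ => noiseLaw ν).map (wordOutput c) =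
      (((Measure.pi fun _ => ν).prod Measure.count).withDensity fun p =>
        ENNReal.ofReal (wordLikelihood c (outputOf p.1 p.2))).map
          fun p => outputOf p.1 p.2 := by
  have (j : ι) : IsProbabilityMeasure ((noiseLaw ν).map (channelOutput (c j))) :=
    Measure.isProbabilityMeasure_map (measurable_channelOutput_right (c j)).aemeasurable
  have law_eq : (Measure.pi fun _ => noiseLaw ν).map (wordOutput c) =
      Measure.pi fun j => (noiseLaw ν).map (channelOutput (c j)) :=
    Measure.pi_map_pi fun j => (measurable_channelOutput_right (c j)).aemeasurable
  simp only [map_channelOutput] at this law_eq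
  rw [law_eq, pi_withDensity_prod_count ν fun j => (measurable_transition_right _).ennreal_ofReal]
  simp only [wordLikelihood, ENNReal.ofReal_prod_of_nonneg fun _ _ => transition_nonneg _ _]
  rfl

theorem integral_wordOutput [DecidableEq ι] (c : ι → ZMod 2) {F : (ι → ChannelSymbol) → ℝ}
    (hF : IsBddMeasurable F) :
    ∫ z, F (wordOutput c z) ∂(Measure.pi fun _ => noiseLaw ν) =
      ∫ e, ∑ u, wordLikelihood c (outputOf e u) * F (outputOf e u) ∂(Measure.pi fun _ => ν) := by
  have hout : Measurable fun p : (ι → Crossover) × (ι → ZMod 2) => outputOf p.1 p.2 := by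
    unfold outputOf
    fun_prop
  have hdens := (isBddMeasurable_wordLikelihood c).comp hout
  have hbdd := ((isBddMeasurable_wordLikelihood c).mul hF).comp hout
  rw [← integral_map (measurable_wordOutput c).aemeasurable hF.1.aestronglyMeasurable,
    map_wordOutput, integral_map hout.aemeasurable hF.1.aestronglyMeasurable,
    integral_withDensity_eq_integral_toReal_smul hdens.1.ennreal_ofReal
      (ae_of_all _ fun _ => ENNReal.ofReal_lt_top)]
  simp only [ENNReal.toReal_ofReal (wordLikelihood_nonneg _ _), smul_eq_mul]
  rw [integral_prod _ (hbdd.integrable _)]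
  simp [integral_fintype]

end Transmission

section MaximumLikelihood

variable {ι : Type} [Fintype ι] (C : Submodule (ZMod 2) (ι → ZMod 2))

open scoped Classical in
/-- The likelihood of `X_i = b` given the outputs at the coordinates in `s` only, for a uniformly
random codeword `X`, without normalization. -/
def partialLikelihood (s : Finset ι) (i : ι) (b : ZMod 2) (y : ι → ChannelSymbol) : ℝ :=
  ∑ c : ι → ZMod 2 with c ∈ C ∧ c i = b, ∏ j ∈ s, transition (c j) (y j)

theorem partialLikelihood_nonneg (s : Finset ι) (i : ι) (b : ZMod 2) (y : ι → ChannelSymbol) :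
    0 ≤ partialLikelihood C s i b y :=
  Finset.sum_nonneg fun _ _ => Finset.prod_nonneg fun _ _ => transition_nonneg _ _

theorem isBddMeasurable_partialLikelihood (s : Finset ι) (i : ι) (b : ZMod 2) :
    IsBddMeasurable (partialLikelihood C s i b) := by
  refine ⟨Finset.measurable_fun_sum _ fun c _ => Finset.measurable_fun_prod _ fun j _ =>
    (measurable_transition_right (c j)).comp (measurable_pi_apply j), ?bound, fun y => ?le⟩
  case le =>
    rw [abs_of_nonneg (partialLikelihood_nonneg C s i b y)]
    exact Finset.sum_le_card_nsmul _ _ 1 fun c _ =>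
      Finset.prod_le_one (fun _ _ => transition_nonneg _ _) fun _ _ => transition_le_one _ _

theorem dependsOn_partialLikelihood (s : Finset ι) (i : ι) (b : ZMod 2) :
    DependsOn (partialLikelihood C s i b) s := fun y y' h => by
  unfold partialLikelihood
  refine Finset.sum_congr rfl fun c _ => Finset.prod_congr rfl fun j hj => ?_
  rw [h j hj]

theorem partialLikelihood_univ [DecidableEq ι] (j : ι) (b : ZMod 2) (y : ι → ChannelSymbol) :
    partialLikelihood C Finset.univ j b y =
      transition b (y j) * partialLikelihood C (Finset.univ.erase j) j b y := by
  classical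
  unfold partialLikelihood
  rw [Finset.mul_sum]
  refine Finset.sum_congr rfl fun c hc => ?_
  rw [← Finset.mul_prod_erase _ _ (Finset.mem_univ j), (Finset.mem_filter.1 hc).2.2]

theorem sum_wordLikelihood_mul [Fintype C] (i : ι) (y : ι → ChannelSymbol) (w : ZMod 2 → ℝ) :
    ∑ c : C, wordLikelihood c y * w (c.1 i) =
      ∑ b, partialLikelihood C Finset.univ i b y * w b := by
  classical
  rw [← Finset.sum_subtype (Finset.univ.filter (· ∈ C)) (by simp)
    fun c => wordLikelihood c y * w (c i), ← Finset.sum_fiberwise _ fun c => c i]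
  refine Finset.sum_congr rfl fun b _ => ?_
  rw [partialLikelihood, Finset.sum_mul, Finset.filter_filter]
  refine Finset.sum_congr rfl fun c hc => ?_
  rw [(Finset.mem_filter.1 hc).2.2, wordLikelihood]

variable {C}

theorem partialLikelihood_wordOutput {c : ι → ZMod 2} (hc : c ∈ C) (s : Finset ι) (i : ι)
    (b : ZMod 2) (z : ι → ChannelSymbol) :
    partialLikelihood C s i (c i + b) (wordOutput c z) = partialLikelihood C s i b z := by
  unfold partialLikelihood
  refine (Finset.sum_equiv (Equiv.addLeft c) (fun c' => ?_) fun c' _ => ?_).symm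
  · simp [C.add_mem_iff_right hc]
  · exact Finset.prod_congr rfl fun j _ => (transition_channelOutput (c j) (c' j) (z j)).symm

section

variable [Fintype C] (ν : Measure Crossover) [IsProbabilityMeasure ν]

theorem sum_integral_wordOutput [DecidableEq ι] (i : ι) {G : ZMod 2 → (ι → ChannelSymbol) → ℝ}
    (hG : ∀ b, IsBddMeasurable (G b)) :
    ∑ c : C, ∫ z, G (c.1 i) (wordOutput c z) ∂(Measure.pi fun _ => noiseLaw ν) =
      ∫ e, ∑ u, ∑ b, partialLikelihood C Finset.univ i b (outputOf e u) * G b (outputOf e u)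
        ∂(Measure.pi fun _ => ν) := by
  have hbdd (c : C) : IsBddMeasurable fun e : ι → Crossover =>
      ∑ u, wordLikelihood c (outputOf e u) * G (c.1 i) (outputOf e u) :=
    .sum fun u =>
      ((isBddMeasurable_wordLikelihood c.1).mul (hG (c.1 i))).comp (measurable_outputOf u)
  simp only [integral_wordOutput ν _ (hG _)]
  rw [← integral_finsetSum _ fun c _ => (hbdd c).integrable _]
  congr 1 with e
  rw [Finset.sum_comm]
  exact Finset.sum_congr rfl fun u _ =>
    sum_wordLikelihood_mul C i (outputOf e u) fun b => G b (outputOf e u)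

theorem sum_integral_wordOutput_mono (i : ι) {G H : ZMod 2 → (ι → ChannelSymbol) → ℝ}
    (hG : ∀ b, IsBddMeasurable (G b)) (hH : ∀ b, IsBddMeasurable (H b))
    (hGH : ∀ y, ∑ b, partialLikelihood C Finset.univ i b y * G b y ≤
      ∑ b, partialLikelihood C Finset.univ i b y * H b y) :
    ∑ c : C, ∫ z, G (c.1 i) (wordOutput c z) ∂(Measure.pi fun _ => noiseLaw ν) ≤
      ∑ c : C, ∫ z, H (c.1 i) (wordOutput c z) ∂(Measure.pi fun _ => noiseLaw ν) := by
  classical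
  have hbdd {G : ZMod 2 → (ι → ChannelSymbol) → ℝ} (hG : ∀ b, IsBddMeasurable (G b)) :
      IsBddMeasurable fun e : ι → Crossover => ∑ u, ∑ b,
        partialLikelihood C Finset.univ i b (outputOf e u) * G b (outputOf e u) :=
    .sum fun u => .sum fun b =>
      ((isBddMeasurable_partialLikelihood ..).mul (hG b)).comp (measurable_outputOf u)
  rw [sum_integral_wordOutput ν i hG, sum_integral_wordOutput ν i hH]
  exact integral_mono ((hbdd hG).integrable _) ((hbdd hH).integrable _) fun e =>
    Finset.sum_le_sum fun u _ => hGH _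

end

variable (C)

/-- The noise vectors under which a maximum likelihood decoder may be wrong about the coordinate
`i`. By linearity of the code they do not depend on the transmitted codeword. -/
def failureSet (i : ι) : Set (ι → ChannelSymbol) :=
  {z | partialLikelihood C Finset.univ i 0 z ≤ partialLikelihood C Finset.univ i 1 z}

variable {C}

theorem mem_failureSet_iff {c : ι → ZMod 2} (hc : c ∈ C) {i : ι} {z : ι → ChannelSymbol} :
    z ∈ failureSet C i ↔ partialLikelihood C Finset.univ i (c i) (wordOutput c z) ≤
      partialLikelihood C Finset.univ i (c i + 1) (wordOutput c z) := by
  have h0 := partialLikelihood_wordOutput hc Finset.univ i 0 z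
  rw [add_zero] at h0
  rw [h0, partialLikelihood_wordOutput hc]
  rfl

variable (ν : Measure Crossover) [IsProbabilityMeasure ν]

theorem bitErrorProbAt_le (p : PMF C) {i : ι} {dec : (ι → ChannelSymbol) → ZMod 2}
    (hdec : IsMLBitDecoder C i dec) :
    bitErrorProbAt ν C p i dec ≤ (Measure.pi fun _ => noiseLaw ν).real (failureSet C i) := by
  have error_subset (c : C) : {z | dec (wordOutput c z) ≠ c.1 i} ⊆ failureSet C i := by
    intro z hz
    have eq_add_one : ∀ {x y : ZMod 2}, x ≠ y → x = y + 1 := by decide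
    have := hdec (wordOutput c z) (c.1 i)
    rw [eq_add_one hz] at this
    exact (mem_failureSet_iff c.2).2 this
  refine ENNReal.toReal_mono (measure_ne_top _ _) ?_
  calc ∑' c : C, p c * Measure.pi (fun _ : ι => noiseLaw ν) {z | dec (wordOutput c z) ≠ c.1 i}
      ≤ ∑' c : C, p c * Measure.pi (fun _ : ι => noiseLaw ν) (failureSet C i) := by
        gcongr with c
        exact error_subset c
    _ = Measure.pi (fun _ : ι => noiseLaw ν) (failureSet C i) := by
        rw [ENNReal.tsum_mul_right, p.tsum_coe, one_mul]

theorem sum_mul_ite_le {L : ZMod 2 → ℝ} (hL : ∀ b, 0 ≤ L b) (d : ZMod 2) :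
    ∑ b, L b * (if L b ≤ L (b + 1) then 1 else 0) ≤ ∑ b, L b * (2 * if d ≠ b then 1 else 0) := by
  have h0 := hL 0
  have h1 := hL 1
  have h2 : (1 : ZMod 2) + 1 = 0 := rfl
  obtain rfl | rfl : d = 0 ∨ d = 1 := by revert d; decide
  all_goals
    simp only [sum_zmod_two, zero_add, h2, ne_eq, zero_ne_one, one_ne_zero, not_true_eq_false,
      not_false_eq_true, if_true, if_false]
    split_ifs <;> linarith

theorem measureReal_failureSet_le (i : ι) {D : (ι → ChannelSymbol) → ZMod 2} (hD : Measurable D)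
    {η : ℝ}
    (hη : ∀ c ∈ C, (Measure.pi fun _ => noiseLaw ν).real {z | D (wordOutput c z) ≠ c i} ≤ η) :
    (Measure.pi fun _ => noiseLaw ν).real (failureSet C i) ≤ 2 * η := by
  have := Fintype.ofFinite C
  set P := Measure.pi fun _ : ι => noiseLaw ν
  set mayFail : ZMod 2 → Set (ι → ChannelSymbol) := fun b =>
    {y | partialLikelihood C Finset.univ i b y ≤ partialLikelihood C Finset.univ i (b + 1) y}
  have measurableSet_mayFail (b : ZMod 2) : MeasurableSet (mayFail b) :=
    have hL (b : ZMod 2) := (isBddMeasurable_partialLikelihood C Finset.univ i b).1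
    measurableSet_le (hL b) (hL (b + 1))
  have measurableSet_err (b : ZMod 2) : MeasurableSet {y | D y ≠ b} :=
    (hD (measurableSet_singleton b)).compl
  have integral_indicator_wordOutput (c : C) {S : Set (ι → ChannelSymbol)} (hS : MeasurableSet S) :
      ∫ z, S.indicator 1 (wordOutput c z) ∂P = P.real (wordOutput c ⁻¹' S) := by
    rw [← integral_indicator_one (measurable_wordOutput c hS)]
    rfl
  have preimage_mayFail (c : C) : wordOutput c ⁻¹' mayFail (c.1 i) = failureSet C i :=
    Set.ext fun z => (mem_failureSet_iff c.2).symm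
  have hcard : (0 : ℝ) < Fintype.card C := by exact_mod_cast Fintype.card_pos
  refine le_of_mul_le_mul_left ?_ hcard
  calc Fintype.card C * P.real (failureSet C i)
      = ∑ c : C, ∫ z, (mayFail (c.1 i)).indicator 1 (wordOutput c z) ∂P := by
        simp [integral_indicator_wordOutput, measurableSet_mayFail, preimage_mayFail]
    _ ≤ ∑ c : C, ∫ z, 2 * {y | D y ≠ c.1 i}.indicator 1 (wordOutput c z) ∂P :=
        sum_integral_wordOutput_mono ν i
          (H := fun b y => 2 * {y | D y ≠ b}.indicator 1 y)
          (fun b => isBddMeasurable_indicator_one (measurableSet_mayFail b))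
          (fun b => (isBddMeasurable_indicator_one (measurableSet_err b)).const_mul 2) fun y => by
            simpa only [mayFail, Set.indicator_apply, Set.mem_ofPred_eq, Pi.one_apply] using
              sum_mul_ite_le (fun b => partialLikelihood_nonneg C Finset.univ i b y) (D y)
    _ ≤ ∑ c : C, 2 * η := by
        gcongr with c
        rw [integral_const_mul, integral_indicator_wordOutput c (measurableSet_err _)]
        exact mul_le_mul_of_nonneg_left (hη c c.2) zero_le_two
    _ = Fintype.card C * (2 * η) := by simp

end MaximumLikelihood

/-! ### Predicting a bit from the other outputs -/

section Prediction

variable {ι : Type} [Fintype ι]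

open scoped Classical in
/-- The difference of the probabilities of `X_j = b` and of `X_j ≠ b` given the outputs at the
coordinates other than `j`, for a uniformly random codeword `X`. -/
def posteriorBias (C : Submodule (ZMod 2) (ι → ZMod 2)) (j : ι) (b : ZMod 2)
    (y : ι → ChannelSymbol) : ℝ :=
  (partialLikelihood C (Finset.univ.erase j) j b y -
      partialLikelihood C (Finset.univ.erase j) j (b + 1) y) /
    (partialLikelihood C (Finset.univ.erase j) j b y +
      partialLikelihood C (Finset.univ.erase j) j (b + 1) y)

variable {C : Submodule (ZMod 2) (ι → ZMod 2)}

theorem abs_posteriorBias_le_one (j : ι) (b : ZMod 2) (y : ι → ChannelSymbol) :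
    |posteriorBias C j b y| ≤ 1 := by
  classical
  have h0 := partialLikelihood_nonneg C (Finset.univ.erase j) j b y
  have h1 := partialLikelihood_nonneg C (Finset.univ.erase j) j (b + 1) y
  rw [posteriorBias, abs_div, abs_of_nonneg (add_nonneg h0 h1)]
  exact div_le_one_of_le₀ (abs_sub_le_iff.2 ⟨by linarith, by linarith⟩) (add_nonneg h0 h1)

theorem isBddMeasurable_posteriorBias (j : ι) (b : ZMod 2) :
    IsBddMeasurable (posteriorBias C j b) := by
  classical
  have hA (b : ZMod 2) := (isBddMeasurable_partialLikelihood C (Finset.univ.erase j) j b).1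
  exact ⟨((hA b).sub (hA (b + 1))).div ((hA b).add (hA (b + 1))), 1, abs_posteriorBias_le_one j b⟩

theorem dependsOn_posteriorBias [DecidableEq ι] (j : ι) (b : ZMod 2) :
    DependsOn (posteriorBias C j b) (Finset.univ.erase j : Finset ι) := fun y y' h => by
  have hA (b : ZMod 2) := dependsOn_partialLikelihood C (Finset.univ.erase j) j b h
  unfold posteriorBias
  convert congrArg₂ (· / ·) (congrArg₂ (· - ·) (hA b) (hA (b + 1)))
    (congrArg₂ (· + ·) (hA b) (hA (b + 1)))

theorem posteriorBias_add_one (j : ι) (b : ZMod 2) (y : ι → ChannelSymbol) :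
    posteriorBias C j (b + 1) y = -posteriorBias C j b y := by
  have : b + 1 + 1 = b := by revert b; decide
  rw [posteriorBias, posteriorBias, this, ← neg_sub, neg_div,
    add_comm (partialLikelihood ..)]

theorem posteriorBias_wordOutput {c : ι → ZMod 2} (hc : c ∈ C) (j : ι) (z : ι → ChannelSymbol) :
    posteriorBias C j (c j) (wordOutput c z) = posteriorBias C j 0 z := by
  classical
  have hA (b : ZMod 2) := partialLikelihood_wordOutput hc (Finset.univ.erase j) j b z
  have h0 := hA 0
  rw [add_zero] at h0
  rw [posteriorBias, posteriorBias, h0, hA 1, zero_add]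

section

variable [DecidableEq ι]

open Function (update)

theorem partialLikelihood_outputOf_update (e : ι → Crossover) (u : ι → ZMod 2) (j : ι)
    (v b : ZMod 2) :
    partialLikelihood C Finset.univ j b (outputOf e (update u j v)) =
      transition b (e j, v) * partialLikelihood C (Finset.univ.erase j) j b (outputOf e u) := by
  rw [partialLikelihood_univ]
  congr 1
  · simp [outputOf]
  · refine dependsOn_partialLikelihood C _ j b fun l hl => ?_
    rw [outputOf, outputOf, Function.update_of_ne (Finset.ne_of_mem_erase hl)]

theorem posteriorBias_outputOf_update (e : ι → Crossover) (u : ι → ZMod 2) (j : ι)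
    (v b : ZMod 2) :
    posteriorBias C j b (outputOf e (update u j v)) = posteriorBias C j b (outputOf e u) :=
  dependsOn_posteriorBias j b fun l hl => by
    rw [outputOf, outputOf, Function.update_of_ne (Finset.ne_of_mem_erase hl)]

theorem cubeEnergy_le_sum_mul_posteriorBias (e : ι → Crossover) (j : ι) :
    cubeEnergy j (fun u => ∑ b, partialLikelihood C Finset.univ j b (outputOf e u)) ≤
      2 * ∑ u, ∑ b, partialLikelihood C Finset.univ j b (outputOf e u) *
        posteriorBias C j b (outputOf e u) := by
  rw [cubeEnergy, sum_eq_sum_update j fun u => ∑ b, _, Finset.mul_sum]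
  refine Finset.sum_le_sum fun u _ => ?_
  set A : ZMod 2 → ℝ := fun b =>
    partialLikelihood C (Finset.univ.erase j) j b (outputOf e u)
  set x : ℝ := (e j : ℝ)
  have hx : (1 - 2 * x) ^ 2 ≤ 1 := by
    obtain ⟨h0, h1⟩ := (e j).2
    rw [sq_le_one_iff_abs_le_one, abs_le]
    constructor <;> linarith
  have bias_zero : posteriorBias C j 0 (outputOf e u) = (A 0 - A 1) / (A 0 + A 1) := by
    unfold posteriorBias
    rw [zero_add]
    congr!
  have bias_one : posteriorBias C j 1 (outputOf e u) = -((A 0 - A 1) / (A 0 + A 1)) := by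
    rw [← bias_zero, ← posteriorBias_add_one, zero_add]
  have hA0 : 0 ≤ A 0 + A 1 :=
    add_nonneg (partialLikelihood_nonneg ..) (partialLikelihood_nonneg ..)
  simp only [partialLikelihood_outputOf_update, posteriorBias_outputOf_update, sum_zmod_two,
    bias_zero, bias_one, transition, if_true, zero_ne_one, one_ne_zero, if_false]
  calc ((1 - x) * A 0 + x * A 1 - (x * A 0 + (1 - x) * A 1)) ^ 2 /
        ((1 - x) * A 0 + x * A 1 + (x * A 0 + (1 - x) * A 1))
      = (1 - 2 * x) ^ 2 * ((A 0 - A 1) ^ 2 / (A 0 + A 1)) := by ring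
    _ ≤ (A 0 - A 1) ^ 2 / (A 0 + A 1) := mul_le_of_le_one_left (by positivity) hx
    _ = _ := by ring

end

theorem sum_prod_mul_log_prod {β : Type*} [Fintype β] {w : ι → β → ℝ}
    (hw : ∀ j, ∑ v, w j v = 1) [DecidableEq ι] :
    ∑ u : ι → β, (∏ l, w l (u l)) * Real.log (∏ l, w l (u l)) =
      ∑ j, ∑ v, w j v * Real.log (w j v) := by
  have split_log (u : ι → β) : (∏ l, w l (u l)) * Real.log (∏ l, w l (u l)) =
      ∑ j, ∏ l, w l (u l) * if l = j then Real.log (w l (u l)) else 1 := by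
    simp only [Finset.prod_mul_distrib, Finset.prod_ite_eq', Finset.mem_univ, if_true,
      ← Finset.mul_sum]
    by_cases h0 : ∏ l, w l (u l) = 0
    · rw [h0, zero_mul, zero_mul]
    · rw [Real.log_prod fun l _ => Finset.prod_ne_zero_iff.1 h0 l (Finset.mem_univ l)]
  simp only [split_log]
  rw [Finset.sum_comm]
  refine Finset.sum_congr rfl fun j _ => ?_
  rw [← Fintype.piFinset_univ, ← Finset.prod_univ_sum (fun _ => Finset.univ)
    fun l v => w l v * if l = j then Real.log (w l v) else 1,
    Finset.prod_eq_single j (fun l _ hl => by simp [hl, hw]) (by simp)]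
  simp

theorem sum_wordLikelihood [DecidableEq ι] (c : ι → ZMod 2) (e : ι → Crossover) :
    ∑ u, wordLikelihood c (outputOf e u) = 1 := by
  unfold wordLikelihood outputOf
  rw [← Fintype.piFinset_univ, ← Finset.prod_univ_sum (fun _ => Finset.univ)
      fun l v => transition (c l) (e l, v)]
  simp [sum_transition]

theorem sum_wordLikelihood_mul_log [DecidableEq ι] (c : ι → ZMod 2) (e : ι → Crossover) :
    ∑ u, wordLikelihood c (outputOf e u) * Real.log (wordLikelihood c (outputOf e u)) =
      -∑ j, Real.binEntropy (e j) := by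
  unfold wordLikelihood outputOf
  rw [sum_prod_mul_log_prod fun j => sum_transition (c j) (e j), ← Finset.sum_neg_distrib]
  refine Finset.sum_congr rfl fun j _ => ?_
  rw [sum_comp_transition (fun t => t * Real.log t),
    Real.binEntropy_eq_negMulLog_add_negMulLog_one_sub, Real.negMulLog, Real.negMulLog]
  ring

theorem neg_card_mul_sum_binEntropy_le [DecidableEq ι] [Fintype C] (e : ι → Crossover) :
    -(Fintype.card C * ∑ j, Real.binEntropy (e j)) ≤
      ∑ u, (∑ c : C, wordLikelihood c (outputOf e u)) *
        Real.log (∑ c : C, wordLikelihood c (outputOf e u)) := by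
  calc -(Fintype.card C * ∑ j, Real.binEntropy (e j))
      = ∑ u, ∑ c : C, wordLikelihood c (outputOf e u) *
          Real.log (wordLikelihood c (outputOf e u)) := by
        rw [Finset.sum_comm]
        simp [sum_wordLikelihood_mul_log]
    _ ≤ _ := by
        refine Finset.sum_le_sum fun u _ => ?_
        rw [Finset.sum_mul]
        refine Finset.sum_le_sum fun c _ => ?_
        rcases (wordLikelihood_nonneg c.1 (outputOf e u)).eq_or_lt with h | h
        · simp [← h]
        · gcongr
          exact Finset.single_le_sum (f := fun c : C => wordLikelihood c (outputOf e u))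
            (fun c _ => wordLikelihood_nonneg _ _) (Finset.mem_univ c)

theorem le_sum_mul_posteriorBias [DecidableEq ι] [Fintype C] (e : ι → Crossover) :
    Fintype.card C * (Fintype.card ι * Real.log 2 - Module.finrank (ZMod 2) C * Real.log 2
        - ∑ j, Real.binEntropy (e j)) ≤
      ∑ j, ∑ u, ∑ b, partialLikelihood C Finset.univ j b (outputOf e u) *
        posteriorBias C j b (outputOf e u) := by
  set f : (ι → ZMod 2) → ℝ := fun u => ∑ c : C, wordLikelihood c (outputOf e u) with hf
  have sum_f : ∑ u, f u = Fintype.card C := by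
    rw [hf, Finset.sum_comm]
    simp [sum_wordLikelihood]
  have log_sum_f : Real.log (Fintype.card C / 2 ^ Fintype.card ι) =
      Module.finrank (ZMod 2) C * Real.log 2 - Fintype.card ι * Real.log 2 := by
    rw [Module.card_eq_pow_finrank (K := ZMod 2) (V := C), ZMod.card, Nat.cast_pow, Nat.cast_two,
      Real.log_div (by positivity) (by positivity), Real.log_pow, Real.log_pow]
  have energy_le (j : ι) := cubeEnergy_le_sum_mul_posteriorBias (C := C) e j
  have f_eq (j : ι) : f = fun u => ∑ b, partialLikelihood C Finset.univ j b (outputOf e u) :=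
    funext fun u => by simpa using sum_wordLikelihood_mul C j (outputOf e u) fun _ => 1
  have log_sobolev := sum_mul_log_le_sum_cubeEnergy fun u =>
    (Finset.sum_nonneg fun c _ => wordLikelihood_nonneg _ _ : 0 ≤ f u)
  rw [sum_f, log_sum_f] at log_sobolev
  have entropy_le := neg_card_mul_sum_binEntropy_le (C := C) e
  have sum_energy_le := Finset.sum_le_sum fun j (_ : j ∈ Finset.univ) =>
    (f_eq j ▸ energy_le j : cubeEnergy j f ≤ _)
  rw [← Finset.mul_sum] at sum_energy_le
  linarith

variable (ν : Measure Crossover) [IsProbabilityMeasure ν]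

theorem card_mul_integral_posteriorBias [DecidableEq ι] [Fintype C] (j : ι) :
    Fintype.card C * ∫ z, posteriorBias C j 0 z ∂(Measure.pi fun _ => noiseLaw ν) =
      ∫ e, ∑ u, ∑ b, partialLikelihood C Finset.univ j b (outputOf e u) *
        posteriorBias C j b (outputOf e u) ∂(Measure.pi fun _ => ν) := by
  rw [← sum_integral_wordOutput ν j (isBddMeasurable_posteriorBias j)]
  simp [posteriorBias_wordOutput]

theorem le_sum_integral_posteriorBias :
    Fintype.card ι * Real.log 2 - Module.finrank (ZMod 2) C * Real.log 2
        - Fintype.card ι * ∫ e, Real.binEntropy (e : ℝ) ∂ν ≤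
      ∑ j, ∫ z, posteriorBias C j 0 z ∂(Measure.pi fun _ => noiseLaw ν) := by
  classical
  have := Fintype.ofFinite C
  have hcard : (0 : ℝ) < Fintype.card C := by exact_mod_cast Fintype.card_pos
  have hbdd (j : ι) : IsBddMeasurable fun e : ι → Crossover => ∑ u, ∑ b,
      partialLikelihood C Finset.univ j b (outputOf e u) * posteriorBias C j b (outputOf e u) :=
    .sum fun u => .sum fun b => ((isBddMeasurable_partialLikelihood ..).mul
      (isBddMeasurable_posteriorBias j b)).comp (measurable_outputOf u)
  have hent (j : ι) : Integrable (fun e : ι → Crossover => Real.binEntropy (e j : ℝ))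
      (Measure.pi fun _ => ν) :=
    integrable_comp_eval (μ := fun _ : ι => ν) (integrable_binEntropy ν)
  have integral_ent (j : ι) : ∫ e : ι → Crossover, Real.binEntropy (e j) ∂(Measure.pi fun _ => ν) =
      ∫ e, Real.binEntropy (e : ℝ) ∂ν :=
    integral_comp_eval (μ := fun _ : ι => ν) (integrable_binEntropy ν).aestronglyMeasurable
  refine le_of_mul_le_mul_left ?_ hcard
  calc Fintype.card C * (Fintype.card ι * Real.log 2 - Module.finrank (ZMod 2) C * Real.log 2
        - Fintype.card ι * ∫ e, Real.binEntropy (e : ℝ) ∂ν)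
      = ∫ e : ι → Crossover, (Fintype.card C * (Fintype.card ι * Real.log 2 -
          Module.finrank (ZMod 2) C * Real.log 2 - ∑ j, Real.binEntropy (e j)) : ℝ)
          ∂(Measure.pi fun _ => ν) := by
        rw [integral_const_mul, integral_sub (integrable_const _)
          (integrable_finsetSum _ fun j _ => hent j), integral_finsetSum _ fun j _ => hent j]
        simp [integral_ent]
    _ ≤ ∫ e, ∑ j, ∑ u, ∑ b, partialLikelihood C Finset.univ j b (outputOf e u) *
          posteriorBias C j b (outputOf e u) ∂(Measure.pi fun _ => ν) :=
        integral_mono (((integrable_const _).sub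
          (integrable_finsetSum _ fun j _ => hent j)).const_mul _)
          (integrable_finsetSum _ fun j _ => (hbdd j).integrable _) le_sum_mul_posteriorBias
    _ = Fintype.card C * ∑ j, ∫ z, posteriorBias C j 0 z ∂(Measure.pi fun _ => noiseLaw ν) := by
        rw [integral_finsetSum _ fun j _ => (hbdd j).integrable _, Finset.mul_sum]
        simp only [card_mul_integral_posteriorBias]

variable (C)

theorem exists_le_integral_posteriorBias [Nonempty ι] :
    ∃ j, Real.log 2 * (capacity ν - codeRate C) ≤
      ∫ z, posteriorBias C j 0 z ∂(Measure.pi fun _ => noiseLaw ν) := by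
  refine (Finset.exists_le_of_sum_le Finset.univ_nonempty ?_).imp fun j h => h.2
  have hN : (0 : ℝ) < Fintype.card ι := by exact_mod_cast Fintype.card_pos
  have card_mul_rate : Fintype.card ι * codeRate C = Module.finrank (ZMod 2) C :=
    mul_div_cancel₀ _ hN.ne'
  have capacity_le := mul_le_mul_of_nonneg_left (capacity_mul_log_two_le ν) hN.le
  refine le_trans ?_ (le_sum_integral_posteriorBias ν)
  rw [Finset.sum_const, nsmul_eq_mul, Finset.card_univ, ← card_mul_rate]
  linarith

end Prediction

/-! ### Boosting by a majority vote -/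

section Boosting

theorem card_filter_mem_image_le {A β γ : Type*} [Fintype A] [DecidableEq γ] {φ : A → β → γ}
    {s : Finset β} (hφ : ∀ w ∈ s, Function.Injective fun a => φ a w) (x : γ) :
    #{a | x ∈ s.image (φ a)} ≤ #s :=
  Finset.card_le_card_of_forall_subsingleton (fun a w => φ a w = x)
    (fun _ ha => Finset.mem_image.1 (Finset.mem_filter.1 ha).2)
    fun w hw _ ha _ ha' => hφ w hw (ha.2.trans ha'.2.symm)

theorem exists_affineMap_family (p : ℕ) [Fact p.Prime] {m m' : ℕ} (hm : m ≠ 0) (hmm : m' ≤ m)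
    (j : Fin m' → ZMod p) (i : Fin m → ZMod p) :
    ∃ φ : (GaloisField p m)ˣ → (Fin m' → ZMod p) →ᵃ[ZMod p] (Fin m → ZMod p),
      (∀ a, Function.Injective (φ a)) ∧ (∀ a, φ a j = i) ∧
      ∀ w ≠ j, Function.Injective fun a => φ a w := by
  obtain ⟨E⟩ : Nonempty (GaloisField p m ≃ₗ[ZMod p] (Fin m → ZMod p)) :=
    ⟨.ofFinrankEq _ _ (by rw [GaloisField.finrank p hm, Module.finrank_fin_fun])⟩
  obtain ⟨T, hT⟩ : ∃ T : (Fin m' → ZMod p) →ₗ[ZMod p] GaloisField p m, Function.Injective T :=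
    finrank_le_iff_exists_linearMap.1 (by
      rwa [GaloisField.finrank p hm, Module.finrank_fin_fun])
  let S (a : (GaloisField p m)ˣ) : (Fin m' → ZMod p) →ₗ[ZMod p] (Fin m → ZMod p) :=
    E.toLinearMap ∘ₗ LinearMap.mulLeft (ZMod p) (a : GaloisField p m) ∘ₗ T
  have S_apply (a w) : S a w = E (a * T w) := rfl
  refine ⟨fun a => (S a).toAffineMap + AffineMap.const _ _ (i - S a j), fun a => ?_, fun a => ?_,
    fun w hw a a' h => ?_⟩
  · intro w w' h
    exact hT (mul_left_cancel₀ a.ne_zero (E.injective (add_right_cancel h)))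
  · exact add_sub_cancel (S a j) i
  · have hTw : T (w - j) ≠ 0 := (map_ne_zero_iff T hT).2 (sub_ne_zero.2 hw)
    have apply_eq (b) : S b w + (i - S b j) = E (b * T (w - j)) + i := by
      rw [S_apply, S_apply, map_sub, mul_sub, map_sub]
      abel
    have h' : S a w + (i - S a j) = S a' w + (i - S a' j) := h
    rw [apply_eq, apply_eq] at h'
    exact Units.ext (mul_right_cancel₀ hTw (E.injective (add_right_cancel h')))

section MajorityVote

variable {ι κ : Type} [Fintype κ] {C' : Submodule (ZMod 2) (κ → ZMod 2)}
  {A : Type*}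

variable (C') in
/-- The value of the bit `j` of a codeword of `C'` preferred by the majority of the sub-blocks
`φ a` of the output, each of them voting with its posterior bias. -/
def majorityVote [Fintype A] (j : κ) (φ : A → κ → ι) (y : ι → ChannelSymbol) : ZMod 2 :=
  if 0 < ∑ a, posteriorBias C' j 0 (y ∘ φ a) then 0 else 1

variable {j : κ} {φ : A → κ → ι}

theorem measurable_posteriorBias_comp (b : ZMod 2) (a : A) :
    Measurable fun y : ι → ChannelSymbol => posteriorBias C' j b (y ∘ φ a) :=
  (isBddMeasurable_posteriorBias j b).1.comp (by unfold Function.comp; fun_prop)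

variable [Fintype A]

theorem measurable_majorityVote : Measurable (majorityVote C' j φ) :=
  .ite (measurableSet_lt measurable_const
      (Finset.measurable_fun_sum _ fun a _ => measurable_posteriorBias_comp 0 a))
    measurable_const measurable_const

theorem sum_posteriorBias_nonpos_of_majorityVote_ne {b : ZMod 2} {y : ι → ChannelSymbol}
    (h : majorityVote C' j φ y ≠ b) : ∑ a, posteriorBias C' j b (y ∘ φ a) ≤ 0 := by
  have eq_or_eq (b : ZMod 2) : b = 0 ∨ b = 1 := by revert b; decide
  obtain rfl | rfl := eq_or_eq b
  · exact not_lt.1 fun hpos => h (if_pos hpos)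
  · have neg (a : A) := posteriorBias_add_one (C := C') j 0 (y ∘ φ a)
    simp only [zero_add] at neg
    simp only [neg, Finset.sum_neg_distrib, neg_nonpos]
    exact (not_le.1 fun hpos => h (if_neg hpos.not_gt)).le

variable [Fintype ι] (ν : Measure Crossover) [IsProbabilityMeasure ν]

theorem measureReal_sum_posteriorBias_nonpos_le [Nonempty A] (hφ : ∀ a, Function.Injective (φ a))
    (hφj : ∀ w ≠ j, Function.Injective fun a => φ a w) {δ : ℝ} (hδ : 0 < δ)
    (hj : δ ≤ ∫ z, posteriorBias C' j 0 z ∂(Measure.pi fun _ => noiseLaw ν)) :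
    (Measure.pi fun _ => noiseLaw ν).real
        {z : ι → ChannelSymbol | ∑ a, posteriorBias C' j 0 (z ∘ φ a) ≤ 0} ≤
      (Fintype.card κ - 1 : ℕ) / (Fintype.card A * δ ^ 2) := by
  classical
  refine measureReal_sum_nonpos_le (S := fun a => (Finset.univ.erase j).image (φ a))
    (fun _ => noiseLaw ν) (measurable_posteriorBias_comp 0)
    (fun a z => abs_posteriorBias_le_one j 0 _) (fun a z z' h => ?dependsOn) (fun i => ?card) hδ
    fun a => ?mean
  case dependsOn =>
    exact dependsOn_posteriorBias j 0 fun w hw => h _ (Finset.mem_image_of_mem (φ a) hw)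
  case card =>
    rw [← Finset.card_univ, ← Finset.card_erase_of_mem (Finset.mem_univ j)]
    exact card_filter_mem_image_le (fun w hw => hφj w (Finset.ne_of_mem_erase hw)) i
  case mean =>
    have hpres := measurePreserving_pi_comp_injective (fun _ => noiseLaw ν) (hφ a)
    rw [← hpres.map_eq, integral_map hpres.aemeasurable
      (isBddMeasurable_posteriorBias j 0).1.aestronglyMeasurable] at hj
    exact hj

theorem measureReal_failureSet_le_of_posteriorBias [Nonempty A]
    {C : Submodule (ZMod 2) (ι → ZMod 2)} {i : ι} (hC : ∀ c ∈ C, ∀ a, c ∘ φ a ∈ C')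
    (hφ : ∀ a, Function.Injective (φ a)) (hφi : ∀ a, φ a j = i)
    (hφj : ∀ w ≠ j, Function.Injective fun a => φ a w) {δ : ℝ} (hδ : 0 < δ)
    (hj : δ ≤ ∫ z, posteriorBias C' j 0 z ∂(Measure.pi fun _ => noiseLaw ν)) :
    (Measure.pi fun _ => noiseLaw ν).real (failureSet C i) ≤
      2 * ((Fintype.card κ - 1 : ℕ) / (Fintype.card A * δ ^ 2)) := by
  refine measureReal_failureSet_le ν i (measurable_majorityVote (C' := C') (j := j) (φ := φ))
    fun c hc => (measureReal_mono fun z hz => ?_).trans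
      (measureReal_sum_posteriorBias_nonpos_le ν hφ hφj hδ hj)
  have vote_eq (a : A) : posteriorBias C' j (c i) (wordOutput c z ∘ φ a) =
      posteriorBias C' j 0 (z ∘ φ a) := by
    rw [← posteriorBias_wordOutput (hC c hc a) j (z ∘ φ a), Function.comp_apply, hφi]
    rfl
  have sum_le := sum_posteriorBias_nonpos_of_majorityVote_ne hz
  simpa only [vote_eq] using! sum_le

end MajorityVote

theorem measureReal_failureSet_reedMuller_le (ν : Measure Crossover) [IsProbabilityMeasure ν]
    {m m' r : ℕ} (hm : m ≠ 0) (hmm : m' ≤ m) {j : Fin m' → ZMod 2} {δ : ℝ} (hδ : 0 < δ)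
    (hj : δ ≤ ∫ z, posteriorBias (reedMuller m' r) j 0 z ∂(Measure.pi fun _ => noiseLaw ν))
    (i : Fin m → ZMod 2) :
    (Measure.pi fun _ => noiseLaw ν).real (failureSet (reedMuller m r) i) ≤
      2 * (2 ^ m' / (2 ^ m * δ ^ 2)) := by
  obtain ⟨φ, hφ, hφi, hφj⟩ := exists_affineMap_family 2 hm hmm j i
  have := Fintype.ofFinite (GaloisField 2 m)ˣ
  have card_units : (Fintype.card (GaloisField 2 m)ˣ : ℝ) = 2 ^ m - 1 := by
    rw [← Nat.card_eq_fintype_card, Nat.card_units, GaloisField.card 2 m hm]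
    push_cast [Nat.one_le_two_pow (n := m)]
    ring
  have card_words : ((Fintype.card (Fin m' → ZMod 2) - 1 : ℕ) : ℝ) = 2 ^ m' - 1 := by
    push_cast [Fintype.card_fun, ZMod.card, Fintype.card_fin, Nat.one_le_two_pow (n := m')]
    ring
  refine (measureReal_failureSet_le_of_posteriorBias ν (φ := fun a => φ a)
    (fun c hc a => comp_affineMap_mem_reedMuller hc (φ a)) hφ hφi hφj hδ hj).trans ?_
  have one_lt : (1 : ℝ) < 2 ^ m := one_lt_pow₀ one_lt_two hm
  have pow_le : (2 : ℝ) ^ m' ≤ 2 ^ m := pow_le_pow_right₀ one_le_two hmm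
  rw [card_units, card_words, ← div_div, ← div_div]
  gcongr ?_ * (?_ / _)
  rw [div_le_div_iff₀ (sub_pos.2 one_lt) (by positivity)]
  linarith

end Boosting

/-! ### Error bounds for Reed–Muller codes -/

section ErrorBounds

section

variable {ι : Type} [Fintype ι] (C : Submodule (ZMod 2) (ι → ZMod 2))

theorem codeRate_nonneg : 0 ≤ codeRate C :=
  div_nonneg (Nat.cast_nonneg _) (Nat.cast_nonneg _)

theorem codeRate_le_one : codeRate C ≤ 1 := by
  refine div_le_one_of_le₀ (Nat.cast_le.2 ?_) (Nat.cast_nonneg _)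
  simpa using Submodule.finrank_le C

theorem bitErrorProb_nonneg (ν : Measure Crossover) (p : PMF C)
    (dec : ι → (ι → ChannelSymbol) → ZMod 2) : 0 ≤ bitErrorProb ν C p dec :=
  Real.iSup_nonneg fun _ => ENNReal.toReal_nonneg

variable (ν : Measure Crossover) [IsProbabilityMeasure ν]

theorem bitErrorProb_le_one (p : PMF C) (dec : ι → (ι → ChannelSymbol) → ZMod 2) :
    bitErrorProb ν C p dec ≤ 1 := by
  refine Real.iSup_le (fun i => ENNReal.toReal_le_of_le_ofReal zero_le_one ?_) zero_le_one
  rw [ENNReal.ofReal_one, ← p.tsum_coe]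
  exact ENNReal.tsum_le_tsum fun c => mul_le_of_le_one_right' prob_le_one

end

variable (ν : Measure Crossover) [IsProbabilityMeasure ν]

theorem capacity_le_one : capacity ν ≤ 1 := by
  have entropy_nonneg : 0 ≤ ∫ e : Crossover, Real.binEntropy e ∂ν :=
    integral_nonneg fun e => Real.binEntropy_nonneg e.2.1 (e.2.2.trans (by norm_num))
  have := capacity_mul_log_two_le ν
  exact le_of_mul_le_mul_right (by linarith) (Real.log_pos one_lt_two)

variable {m r : ℕ} (p : PMF (reedMuller m r))
  {dec : (Fin m → ZMod 2) → ((Fin m → ZMod 2) → ChannelSymbol) → ZMod 2}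

theorem bitErrorProb_reedMuller_le_of_codeRate_sub {l : ℕ} (hm : m ≠ 0) (hl : l ≤ m)
    (hdec : ∀ i, IsMLBitDecoder (reedMuller m r) i (dec i)) {δ : ℝ} (hδ : 0 < δ)
    (hrate : codeRate (reedMuller (m - l) r) + δ ≤ capacity ν) :
    bitErrorProb ν (reedMuller m r) p dec ≤
      2 / (Real.log 2 * δ) ^ 2 * (2 : ℝ) ^ (-(l : ℝ)) := by
  have : 0 < Real.log 2 := Real.log_pos one_lt_two
  obtain ⟨j, hj⟩ := exists_le_integral_posteriorBias (reedMuller (m - l) r) ν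
  have gap_le : Real.log 2 * δ ≤ Real.log 2 * (capacity ν - codeRate (reedMuller (m - l) r)) := by
    gcongr
    linarith
  have two_pow_eq : (2 : ℝ) ^ m = 2 ^ (m - l) * 2 ^ l := by rw [← pow_add, Nat.sub_add_cancel hl]
  refine ciSup_le fun i => ?_
  calc bitErrorProbAt ν (reedMuller m r) p i (dec i)
      ≤ (Measure.pi fun _ => noiseLaw ν).real (failureSet (reedMuller m r) i) :=
        bitErrorProbAt_le ν p (hdec i)
    _ ≤ 2 * (2 ^ (m - l) / (2 ^ m * (Real.log 2 * δ) ^ 2)) :=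
        measureReal_failureSet_reedMuller_le ν hm (Nat.sub_le m l) (by positivity)
          (gap_le.trans hj) i
    _ = 2 / (Real.log 2 * δ) ^ 2 * (2 : ℝ) ^ (-(l : ℝ)) := by
        rw [Real.rpow_neg zero_le_two, Real.rpow_natCast, two_pow_eq]
        field_simp

theorem bitErrorProb_reedMuller_le (hdec : ∀ i, IsMLBitDecoder (reedMuller m r) i (dec i))
    {δ : ℝ} (hδ : 0 < δ) (hrate : codeRate (reedMuller m r) + 2 * δ ≤ capacity ν) :
    bitErrorProb ν (reedMuller m r) p dec ≤
      4 / (Real.log 2 * δ) ^ 2 * (2 : ℝ) ^ (-(δ * √m)) := by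
  have : 0 < Real.log 2 := Real.log_pos one_lt_two
  have δ_le : δ ≤ 1 / 2 := by
    linarith [capacity_le_one ν, codeRate_nonneg (reedMuller m r)]
  obtain rfl | hm := m.eq_zero_or_pos
  · have mul_le : Real.log 2 * δ ≤ 1 := by nlinarith [Real.log_two_lt_d9]
    refine (bitErrorProb_le_one _ ν p dec).trans ?_
    rw [Nat.cast_zero, Real.sqrt_zero, mul_zero, neg_zero, Real.rpow_zero, mul_one,
      one_le_div (by positivity)]
    exact (pow_le_one₀ (by positivity) mul_le).trans (by norm_num)
  have sqrt_pos : 0 < √(m : ℝ) := Real.sqrt_pos.2 (Nat.cast_pos.2 hm)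
  have one_le_sqrt : 1 ≤ √(m : ℝ) := Real.one_le_sqrt.2 (Nat.one_le_cast.2 hm)
  set l := ⌊δ * √m⌋₊
  have le_l : δ * √m ≤ 1 + l := by linarith [Nat.lt_floor_add_one (δ * √m)]
  have l_le : l ≤ δ * √m := Nat.floor_le (by positivity)
  have two_mul_l_le : 2 * l ≤ m := by
    have : (2 * l : ℝ) ≤ m := by nlinarith [Real.mul_self_sqrt (Nat.cast_nonneg (α := ℝ) m)]
    exact_mod_cast this
  have div_le : l / √(m : ℝ) ≤ δ := (div_le_iff₀ sqrt_pos).2 l_le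
  have rate_sub_le := codeRate_reedMuller_sub_le r two_mul_l_le hm
  calc bitErrorProb ν (reedMuller m r) p dec
      ≤ 2 / (Real.log 2 * δ) ^ 2 * (2 : ℝ) ^ (-(l : ℝ)) :=
        bitErrorProb_reedMuller_le_of_codeRate_sub ν p hm.ne' (by lia) hdec hδ (by linarith)
    _ ≤ 2 / (Real.log 2 * δ) ^ 2 * (2 : ℝ) ^ (1 + -(δ * √m)) := by
        gcongr
        · exact one_le_two
        · linarith
    _ = 4 / (Real.log 2 * δ) ^ 2 * (2 : ℝ) ^ (-(δ * √m)) := by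
        rw [Real.rpow_add two_pos, Real.rpow_one]
        ring

theorem isBigO_two_rpow_neg_mul_sqrt {δ : ℝ} (hδ : 0 < δ) :
    (fun m : ℕ => (2 : ℝ) ^ (-(δ * √m))) =O[atTop] fun m : ℕ =>
      (2 : ℝ) ^ (-(√(Real.logb 2 (blockLength m))
        / Real.logb 2 (Real.logb 2 (blockLength m)))) := by
  have logb_blockLength (m : ℕ) : Real.logb 2 (blockLength m) = m := by
    rw [blockLength, Nat.cast_pow, Nat.cast_two, Real.logb_pow,
      Real.logb_self_eq_one one_lt_two, mul_one]
  simp only [logb_blockLength]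
  refine .of_norm_eventuallyLE ?_
  filter_upwards [((Real.tendsto_logb_atTop one_lt_two).comp
    tendsto_natCast_atTop_atTop).eventually_ge_atTop (1 / δ)] with m hlog
  have logb_pos : 0 < Real.logb 2 m := (one_div_pos.2 hδ).trans_le hlog
  rw [Real.norm_of_nonneg (by positivity)]
  refine Real.rpow_le_rpow_of_exponent_le one_le_two (neg_le_neg ?_)
  rw [div_le_iff₀ logb_pos, mul_right_comm]
  exact le_mul_of_one_le_left (Real.sqrt_nonneg _) ((div_le_iff₀' hδ).1 hlog)

theorem mainTheorem2_general {κ : Type*} {l : Filter κ} (m r : κ → ℕ)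
    (hrate : limsup (fun k => codeRate (reedMuller (m k) (r k))) l < capacity ν)
    (p : ∀ k, PMF (reedMuller (m k) (r k)))
    (dec : ∀ k, (Fin (m k) → ZMod 2) → ((Fin (m k) → ZMod 2) → ChannelSymbol) → ZMod 2)
    (hdec : ∀ k i, IsMLBitDecoder (reedMuller (m k) (r k)) i (dec k i)) :
    ∃ δ > 0, (fun k => bitErrorProb ν (reedMuller (m k) (r k)) (p k) (dec k)) =O[l]
      fun k => (2 : ℝ) ^ (-(δ * √(m k))) := by
  obtain ⟨ρ, limsup_lt, lt_capacity⟩ := exists_between hrate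
  have rate_lt : ∀ᶠ k in l, codeRate (reedMuller (m k) (r k)) < ρ :=
    eventually_lt_of_limsup_lt limsup_lt
      (isBoundedUnder_of ⟨1, fun k => codeRate_le_one (reedMuller (m k) (r k))⟩)
  have gap_pos : 0 < (capacity ν - ρ) / 2 := by linarith
  refine ⟨_, gap_pos, .of_bound (4 / (Real.log 2 * ((capacity ν - ρ) / 2)) ^ 2) ?_⟩
  filter_upwards [rate_lt] with k rate_lt_k
  rw [Real.norm_of_nonneg (bitErrorProb_nonneg ..), Real.norm_of_nonneg (by positivity)]
  exact bitErrorProb_reedMuller_le ν (p k) (hdec k) gap_pos (by linarith)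

end ErrorBounds

end

theorem mainTheorem2 (ν : Measure Crossover) [IsProbabilityMeasure ν]
    (m r : ℕ → ℕ) (hm : Tendsto m atTop atTop)
    (hrate : limsup (fun k => codeRate (reedMuller (m k) (r k))) atTop < capacity ν)
    (p : ∀ k, PMF (reedMuller (m k) (r k)))
    (dec : ∀ k, (Fin (m k) → ZMod 2) → ((Fin (m k) → ZMod 2) → ChannelSymbol) → ZMod 2)
    (hdec : ∀ k i, IsMLBitDecoder (reedMuller (m k) (r k)) i (dec k i)) :
    (fun k => bitErrorProb ν (reedMuller (m k) (r k)) (p k) (dec k)) =O[atTop]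
      fun k => (2 : ℝ) ^ (-(√(Real.logb 2 (blockLength (m k)))
        / Real.logb 2 (Real.logb 2 (blockLength (m k))))) := by
  obtain ⟨δ, hδ, isBigO⟩ := mainTheorem2_general ν m r hrate p dec hdec
  exact isBigO.trans ((isBigO_two_rpow_neg_mul_sqrt hδ).comp_tendsto hm)
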